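/- Let $\overline{\mathcal{C}}(n;k;i,j)$ denote the number of jagged overpartitions of $n$, that is, of finite sequences $(\lambda_1,\dots,\lambda_s)$ of positive integers (not necessarily non-increasing) with sum $n$, in which only the final occurrence of an integer may be overlined, that satisfy the following conditions: exactly $k$ of the parts are non-overlined; exactly $i$ (resp. $j$) of the parts are congruent to $1$ (resp. $2$) modulo $3$; $\lambda_s \neq \overline{1}$; for all $1 \le m < s$, $$ \lambda_m -\lambda_{m+1} \geq \begin{cases} -1+3 \chi(\overline{\lambda_m}) & \text{if } \lambda_m + \lambda_{m+1} \equiv 0 \pmod 3, \\ 1 + 3 \chi(\overline{\lambda_m}) & \text{otherwise}, \end{cases}$$ where $\chi(\overline{\lambda_m})$ is $1$ if $\lambda_m$ is overlined and $0$ otherwise; and the final $t$ parts are overlined, where $t$ is the number of parts congruent to $0$ or $2$ modulo $3$. Let $\overline{\mathcal{D}}(n;k;i,j)$ denote the number of partitions of $n$ into distinct parts not congruent to $5$ modulo $6$, exactly $i$ (resp. $j$) of which are congruent to $1$ (resp. $2$) modulo $3$, and such that exactly $k$ of the indices $1 \le m \le r$ satisfy $\lambda^{(1)}_m - \lambda^{(1)}_{m+1}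 \equiv 3 \pmod 6$, where $\lambda^{(1)}_1 > \dots > \lambda^{(1)}_r$ are the parts congruent to $1$ modulo $3$ and $\lambda^{(1)}_{r+1} = -2$. Then $\overline{\mathcal{C}}(n;k;i,j) = \overline{\mathcal{D}}(n;k;i,j)$ for all integers $n,k,i,j \ge 0$. -/

import Mathlib

namespace Capparelli

/-- A part that may or may not be overlined: its size, and whether it is overlined. -/
@[ext]
structure OverPart where
  size : ℕ
  overlined : Bool
  deriving DecidableEq

/-- The indicator `χ` of a part being overlined. -/
def OverPart.chi (x : OverPart) : ℤ := if x.overlined = true then 1 else 0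

/-- The least allowed value of `x - y` when the part `x` is immediately followed by `y`. -/
def minDiff (x y : OverPart) : ℤ :=
  if x.size + y.size ≡ 0 [MOD 3] then -1 + 3 * x.chi else 1 + 3 * x.chi

/-- The number of parts of the sequence `l` congruent to `r` modulo `3`. -/
def numMod3 (r : ℕ) (l : List OverPart) : ℕ := l.countP (fun x => x.size ≡ r [MOD 3])

/-- The number of non-overlined parts of the sequence `l`. -/
def numPlain (l : List OverPart) : ℕ := l.countP (fun x => x.overlined = false)

/-- The last `t` parts of `l` are all overlined. -/
def LastOverlined (t : ℕ) (l : List OverPart) : Prop :=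
  t ≤ l.length ∧ ∀ x ∈ l.drop (l.length - t), x.overlined = true

/-- `l` is one of the jagged overpartitions `(λ₁, …, λ_s)` of `n` under consideration. The parts
are listed in order; they need not be decreasing. -/
structure IsJagged (n : ℕ) (l : List OverPart) : Prop where
  /-- all parts are positive -/
  pos : ∀ x ∈ l, 0 < x.size
  /-- the parts sum to `n` -/
  sum_eq : (l.map OverPart.size).sum = n
  /-- only the final occurrence of an integer may be overlined -/
  final_occurrence : l.Pairwise (fun x y => x.overlined = true → x.size ≠ y.size)
  /-- the last part is not an overlined `1` -/
  last_ne : ∀ x ∈ l.getLast?, x ≠ ⟨1, true⟩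
  /-- the difference condition on successive parts -/
  diff : l.IsChain (fun x y => minDiff x y ≤ (x.size : ℤ) - (y.size : ℤ))
  /-- the final `t` parts are overlined, where `t` counts the parts that are `0` or `2` mod `3` -/
  last_overlined : LastOverlined (numMod3 0 l + numMod3 2 l) l

/-- The jagged overpartitions of `n` with `k` non-overlined parts, `i` parts congruent to `1` and
`j` parts congruent to `2` modulo `3`. -/
def jaggedSet (n k i j : ℕ) : Set (List OverPart) :=
  {l | IsJagged n l ∧ numPlain l = k ∧ numMod3 1 l = i ∧ numMod3 2 l = j}

/-- There are only finitely many such jagged overpartitions, so that counting them makes sense. -/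
theorem jaggedSet_finite (n k i j : ℕ) : (jaggedSet n k i j).Finite := by
  have key : ∀ l ∈ jaggedSet n k i j, l.length ≤ n ∧ ∀ x ∈ l, x.size ≤ n := by
    rintro l ⟨h, -⟩
    refine ⟨?_, fun x hx => ?_⟩
    · have h1 := List.length_le_sum_of_one_le (l.map OverPart.size) (by
        intro m hm
        obtain ⟨x, hx, rfl⟩ := List.mem_map.1 hm
        exact h.pos x hx)
      rw [h.sum_eq, List.length_map] at h1
      exact h1
    · have h2 := List.single_le_sum (l := l.map OverPart.size) (by simp) x.size
        (List.mem_map_of_mem hx)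
      rwa [h.sum_eq] at h2
  let f : List (Fin (n + 1) × Bool) → List OverPart := List.map (fun p => ⟨p.1, p.2⟩)
  refine ((List.finite_length_le (Fin (n + 1) × Bool) n).image f).subset ?_
  intro l hl
  obtain ⟨h1, h2⟩ := key l hl
  refine ⟨l.map (fun x => (Fin.ofNat (n + 1) x.size, x.overlined)), by simpa using h1, ?_⟩
  simp only [f, List.map_map]
  refine (List.map_congr_left (fun x hx => ?_)).trans (List.map_id l)
  have := Nat.mod_eq_of_lt (Nat.lt_succ_of_le (h2 x hx))
  ext <;> simp_all

/-- `C(n; k; i, j)`: the number of jagged overpartitions in `jaggedSet n k i j`. -/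
noncomputable def countC (n k i j : ℕ) : ℕ := (jaggedSet n k i j).ncard

/-- The subpartition of the parts of `p` congruent to `1` modulo `3`, in decreasing order, followed
by the phantom part `-2`. -/
def oneModThree {n : ℕ} (p : n.Partition) : List ℤ :=
  ((p.parts.filter (fun m => m ≡ 1 [MOD 3])).sort (· ≥ ·)).map (fun m : ℕ => (m : ℤ)) ++ [-2]

/-- The number of pairs of successive entries of `l` whose difference is `3` modulo `6`. -/
def numChanges (l : List ℤ) : ℕ := (l.zip l.tail).countP (fun p => p.1 - p.2 ≡ 3 [ZMOD 6])

/-- `D(n; k; i, j)`: the number of partitions of `n` into distinct parts not congruent to `5`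
modulo `6`, with `i` parts congruent to `1` and `j` parts congruent to `2` modulo `3`, and with `k`
differences congruent to `3` modulo `6` between successive parts congruent to `1` modulo `3`. -/
def countD (n k i j : ℕ) : ℕ :=
  ((Finset.univ : Finset n.Partition).filter (fun p =>
    p.parts.Nodup ∧ (∀ m ∈ p.parts, ¬ m ≡ 5 [MOD 6]) ∧
    p.parts.countP (fun m => m ≡ 1 [MOD 3]) = i ∧
    p.parts.countP (fun m => m ≡ 2 [MOD 3]) = j ∧
    numChanges (oneModThree p) = k)).card

end Capparelli

namespace Capparelli
open PowerSeries Finset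

/-! The two counts are compared through generating functions in `X`, for fixed `k`, `i`, `j`, split
by the number `z` of parts divisible by 3. The terms for a given `z` differ; only their sums over
`z` agree.

Jagged side. Read the parts from last to first and replace each size by its height, a third of it
rounded up. The difference condition then says that heights rise by at least `minGap`, which is 0 or
1 according to two residues, plus 1 at an overlined part (`minDiff_le_iff`). The condition on the
last part is nearly the same inequality over a phantom part of residue 1 and height 0. A jagged
overpartition thus becomes a list of residues, overlines and free slacks in `ℕ`. Peeling off the
smallest part gives a recursion whose solution is a product (`gf_gapSet`): the overlining factor
`overlineGF` times a factor containing a Gaussian binomial in `X ^ 2` for the residues 1 and 2.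

Distinct side. The parts in the three residue classes are `3h`, `6h - 4` and `3h - 2` for
independent finite sets of positive `h`, with generating functions `A z`, `B` and `E`. A difference
in the last class is 3 modulo 6 exactly when the diminished gap is even, so odd gaps play the role
of overlines and `overlineGF` reappears (`gf_changeSet`).

Comparison. Forcing the smallest parts to be overlined costs only a monomial (`overlineGF_add`).
Hence, up to a factor `X ^ j`, the jagged term for `z` is `B * E * qPochNeg N * X ^ (z * N) * A z`
with `N = i + j`, against `A z * B * E`. Summed over `z` these agree: a finite set of positive
integers is a subset of `{1, …, N}` together with a set of integers exceeding `N`.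
`X_pow_dvd_sum_sub` is the truncated form of this identity. -/

/-- The set of elements of `S` of weight `n`. -/
def fiber {α : Type*} (w : α → ℕ) (S : Set α) (n : ℕ) : Set α := {a | a ∈ S ∧ w a = n}

/-- All the sets of elements of `S` of given weight are finite. -/
def FinFib {α : Type*} (w : α → ℕ) (S : Set α) : Prop := ∀ n, (fiber w S n).Finite

/-- The generating function of the elements of `S` by weight. -/
noncomputable def gf {α : Type*} (w : α → ℕ) (S : Set α) : ℤ⟦X⟧ :=
  PowerSeries.mk fun n => ((fiber w S n).ncard : ℤ)

/-! ### Sum, shift and product rules for generating functions -/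

section gf
variable {α β : Type*}

theorem coeff_gf (w : α → ℕ) (S : Set α) (n : ℕ) :
    coeff n (gf w S) = ((fiber w S n).ncard : ℤ) := by simp [gf]

theorem gf_empty (w : α → ℕ) : gf w ∅ = 0 := by
  ext n; simp [coeff_gf, fiber]

theorem finFib_empty (w : α → ℕ) : FinFib w ∅ := by
  intro n; simp [fiber]

theorem finFib_singleton (w : α → ℕ) (a : α) : FinFib w {a} := by
  intro n; exact (Set.finite_singleton a).subset fun x hx => hx.1

theorem gf_singleton (w : α → ℕ) (a : α) : gf w {a} = X ^ w a := by
  ext n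
  rw [coeff_gf, coeff_X_pow]
  split_ifs with h
  · have : fiber w {a} n = {a} := by
      ext x; simp only [fiber, Set.mem_singleton_iff, Set.mem_ofPred_eq]
      constructor
      · exact fun h => h.1
      · rintro rfl; exact ⟨rfl, h.symm⟩
    simp [this]
  · have : fiber w {a} n = ∅ := by
      ext x; simp only [fiber, Set.mem_singleton_iff, Set.mem_ofPred_eq, Set.mem_empty_iff_false,
        iff_false]
      rintro ⟨rfl, h'⟩; exact h h'.symm
    simp [this]

theorem gf_image (w : α → ℕ) (w' : β → ℕ) (f : α → β) (S : Set α) (e : ℕ)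
    (hf : Set.InjOn f S) (hw : ∀ a ∈ S, w' (f a) = e + w a) :
    gf w' (f '' S) = X ^ e * gf w S := by
  ext n
  rw [coeff_X_pow_mul', coeff_gf]
  split_ifs with h
  · have : fiber w' (f '' S) n = f '' fiber w S (n - e) := by
      ext b; constructor
      · rintro ⟨⟨a, ha, rfl⟩, h2⟩
        exact ⟨a, ⟨ha, by rw [hw a ha] at h2; omega⟩, rfl⟩
      · rintro ⟨a, ⟨ha, h2⟩, rfl⟩
        exact ⟨⟨a, ha, rfl⟩, by rw [hw a ha]; omega⟩
    rw [this, coeff_gf, Set.InjOn.ncard_image (hf.mono fun a ha => ha.1)]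
  · have : fiber w' (f '' S) n = ∅ := by
      ext b; simp only [Set.mem_empty_iff_false, iff_false]
      rintro ⟨⟨a, ha, rfl⟩, h2⟩
      rw [hw a ha] at h2; omega
    simp [this]

theorem finFib_image (w : α → ℕ) (w' : β → ℕ) (f : α → β) (S : Set α) (e : ℕ)
    (hw : ∀ a ∈ S, w' (f a) = e + w a) (h : FinFib w S) : FinFib w' (f '' S) := by
  intro n
  refine ((h (n - e)).image f).subset ?_
  rintro b ⟨⟨a, ha, rfl⟩, h2⟩
  exact ⟨a, ⟨ha, by rw [hw a ha] at h2; omega⟩, rfl⟩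

theorem gf_union (w : α → ℕ) (S T : Set α) (hS : FinFib w S) (hT : FinFib w T)
    (h : Disjoint S T) : gf w (S ∪ T) = gf w S + gf w T := by
  ext n
  have h1 : fiber w (S ∪ T) n = fiber w S n ∪ fiber w T n := by
    ext a; simp only [fiber, Set.mem_union, Set.mem_ofPred_eq]; tauto
  have h2 : Disjoint (fiber w S n) (fiber w T n) :=
    h.mono (fun a ha => ha.1) (fun a ha => ha.1)
  rw [map_add, coeff_gf, coeff_gf, coeff_gf, h1, Set.ncard_union_eq h2 (hS n) (hT n)]
  push_cast; rfl

theorem finFib_biUnion {κ : Type*} (w : α → ℕ) (S : κ → Set α) (s : Finset κ)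
    (hS : ∀ y, FinFib w (S y)) : FinFib w (⋃ y ∈ s, S y) := by
  intro n
  refine (s.finite_toSet.biUnion fun y _ => hS y n).subset ?_
  rintro a ⟨ha, h⟩
  simp only [Set.mem_iUnion] at ha ⊢
  obtain ⟨y, hy, ha⟩ := ha
  exact ⟨y, hy, ha, h⟩

theorem gf_biUnion {κ : Type*} (w : α → ℕ) (S : κ → Set α) (s : Finset κ)
    (hS : ∀ y, FinFib w (S y)) (h : ∀ y y', y ≠ y' → Disjoint (S y) (S y')) :
    gf w (⋃ y ∈ s, S y) = ∑ y ∈ s, gf w (S y) := by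
  classical
  induction s using Finset.induction_on with
  | empty => simp [gf_empty]
  | insert y s hy ih =>
    rw [Finset.set_biUnion_insert, gf_union w _ _ (hS y) (finFib_biUnion w S s hS), ih,
      Finset.sum_insert hy]
    rw [Set.disjoint_iUnion₂_right]
    intro y' hy'
    exact h y y' (by rintro rfl; exact hy hy')

theorem gf_prod (w : α → ℕ) (w' : β → ℕ) (S : Set α) (T : Set β) (hS : FinFib w S)
    (hT : FinFib w' T) :
    gf (fun p : α × β => w p.1 + w' p.2) (S ×ˢ T) = gf w S * gf w' T := by
  classical
  ext n
  have h1 : fiber (fun p : α × β => w p.1 + w' p.2) (S ×ˢ T) n =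
      ↑((antidiagonal n).biUnion fun p => (hS p.1).toFinset ×ˢ (hT p.2).toFinset) := by
    ext ⟨a, b⟩
    simp only [fiber, Set.mem_prod, Set.mem_ofPred_eq, coe_biUnion, mem_coe, Finset.HasAntidiagonal.mem_antidiagonal,
      coe_product, Set.Finite.coe_toFinset, Set.mem_iUnion, Prod.exists, exists_prop]
    constructor
    · rintro ⟨⟨ha, hb⟩, h⟩
      exact ⟨_, _, h, ⟨ha, rfl⟩, ⟨hb, rfl⟩⟩
    · rintro ⟨_, _, h, ⟨ha, rfl⟩, ⟨hb, rfl⟩⟩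
      exact ⟨⟨ha, hb⟩, h⟩
  rw [coeff_gf, h1, Set.ncard_coe_finset, coeff_mul, Finset.card_biUnion]
  · push_cast
    refine Finset.sum_congr rfl fun p _ => ?_
    rw [coeff_gf, coeff_gf, Finset.card_product, Set.ncard_eq_toFinset_card _ (hS p.1),
      Set.ncard_eq_toFinset_card _ (hT p.2)]
    push_cast; rfl
  · intro p _ p' _ hpp
    rw [Function.onFun, Finset.disjoint_left]
    rintro ⟨a, b⟩ h h'
    simp only [mem_product, Set.Finite.mem_toFinset, fiber, Set.mem_ofPred_eq] at h h'
    exact hpp (Prod.ext (h.1.2.symm.trans h'.1.2) (h.2.2.symm.trans h'.2.2))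

theorem finFib_prod (w : α → ℕ) (w' : β → ℕ) (S : Set α) (T : Set β) (hS : FinFib w S)
    (hT : FinFib w' T) : FinFib (fun p : α × β => w p.1 + w' p.2) (S ×ˢ T) := by
  intro n
  refine (((Set.finite_Iic n).biUnion fun m _ => hS m).prod
    ((Set.finite_Iic n).biUnion fun m _ => hT m)).subset ?_
  rintro ⟨a, b⟩ ⟨⟨ha, hb⟩, h⟩
  simp only at h ha hb
  simp only [Set.mem_prod, Set.mem_iUnion]
  exact ⟨⟨w a, by simp; omega, ha, rfl⟩, ⟨w' b, by simp; omega, hb, rfl⟩⟩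

end gf

/-! ### Peeling the first entry off a list -/

section cons
variable {α κ : Type*}

/-- Increase the numerical component of the head of a list. -/
def bump (f : κ × ℕ ≃ α) : List α → List α
  | [] => []
  | a :: l => f ((f.symm a).1, (f.symm a).2 + 1) :: l

theorem bump_injective (f : κ × ℕ ≃ α) : Function.Injective (bump f) := by
  intro l l' h
  match l, l', h with
  | [], [], _ => rfl
  | a :: l, b :: l', h =>
    simp only [bump, List.cons.injEq, EmbeddingLike.apply_eq_iff_eq, Prod.mk.injEq,
      Nat.add_right_cancel_iff] at h
    obtain ⟨⟨h1, h2⟩, rfl⟩ := h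
    rw [f.symm.injective (Prod.ext h1 h2)]

variable [Fintype κ] (f : κ × ℕ ≃ α) (S : Set (List α)) (w : List α → ℕ)
  (S' : κ → Set (List α)) (w' : κ → List α → ℕ) (e : κ → ℕ) (s : ℕ)

theorem finFib_cons (hs : 0 < s) (hnil : [] ∉ S)
    (hmem : ∀ y g l, f (y, g) :: l ∈ S ↔ l ∈ S' y)
    (hw : ∀ y g l, l ∈ S' y → w (f (y, g) :: l) = s * g + e y + w' y l)
    (hfin : ∀ y, FinFib (w' y) (S' y)) : FinFib w S := by
  intro n
  refine (Set.finite_iUnion fun y : κ => (Set.finite_Iic n).biUnion fun g _ =>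
    ((Set.finite_Iic n).biUnion fun m _ => hfin y m).image (f (y, g) :: ·)).subset ?_
  rintro l ⟨hl, h⟩
  match l, hl, h with
  | [], hl, _ => exact absurd hl hnil
  | a :: l, hl, h =>
    obtain ⟨⟨y, g⟩, rfl⟩ := f.surjective a
    have hl' := (hmem y g l).1 hl
    rw [hw y g l hl'] at h
    have : g ≤ s * g := Nat.le_mul_of_pos_left g hs
    simp only [Set.mem_iUnion]
    refine ⟨y, g, by simp; omega, l, ?_, rfl⟩
    simp only [Set.mem_iUnion]
    exact ⟨w' y l, by simp; omega, hl', rfl⟩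

/-- The numerical component of the head is free and each unit of it weighs `s`. So `S` is the
disjoint union of the lists whose head has component 0 and of its own image under `bump`, which adds
`s` to the weight; solving for the generating function gives the factor `1 - X ^ s`. -/
theorem gf_cons (hs : 0 < s) (hnil : [] ∉ S)
    (hmem : ∀ y g l, f (y, g) :: l ∈ S ↔ l ∈ S' y)
    (hw : ∀ y g l, l ∈ S' y → w (f (y, g) :: l) = s * g + e y + w' y l)
    (hfin : ∀ y, FinFib (w' y) (S' y)) :
    gf w S * (1 - X ^ s) = ∑ y, X ^ e y * gf (w' y) (S' y) := by
  have hS : FinFib w S := finFib_cons f S w S' w' e s hs hnil hmem hw hfin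
  have hw0 : ∀ y, ∀ l ∈ S' y, w (f (y, 0) :: l) = e y + w' y l := fun y l hl => by
    rw [hw y 0 l hl]; simp
  have hwb : ∀ l ∈ S, w (bump f l) = s + w l := by
    intro l hl
    match l, hl with
    | [], hl => exact absurd hl hnil
    | a :: l, hl =>
      obtain ⟨⟨y, g⟩, rfl⟩ := f.surjective a
      have hl' := (hmem y g l).1 hl
      simp only [bump, Equiv.symm_apply_apply]
      rw [hw y _ l hl', hw y _ l hl']; ring
  have hsplit : S = (⋃ y ∈ (Finset.univ : Finset κ), (f (y, 0) :: ·) '' S' y) ∪ bump f '' S := by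
    ext l
    match l with
    | [] =>
      simp only [Set.mem_union, Set.mem_iUnion, Set.mem_image]
      constructor
      · exact fun h => absurd h hnil
      · rintro (⟨y, -, l, -, h⟩ | ⟨l, hl, h⟩)
        · exact absurd h (by simp)
        · match l, hl, h with
          | [], hl, _ => exact hl
    | a :: l =>
      obtain ⟨⟨y, g⟩, rfl⟩ := f.surjective a
      constructor
      · intro hl
        have hl' := (hmem y g l).1 hl
        match g with
        | 0 =>
          left
          simp only [Set.mem_iUnion]
          exact ⟨y, Finset.mem_univ y, l, hl', rfl⟩
        | g + 1 =>
          right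
          exact ⟨f (y, g) :: l, (hmem y g l).2 hl', by simp [bump]⟩
      · rintro (h | ⟨l1, hl1, h⟩)
        · simp only [Set.mem_iUnion] at h
          obtain ⟨y', -, l', hl', h⟩ := h
          rw [← h]; exact (hmem y' 0 l').2 hl'
        · match l1, hl1, h with
          | b :: l1, hl1, h =>
            obtain ⟨⟨y1, g1⟩, rfl⟩ := f.surjective b
            simp only [bump, Equiv.symm_apply_apply] at h
            rw [← h]
            exact (hmem _ _ _).2 ((hmem _ _ _).1 hl1)
  have hf0 : ∀ y, FinFib w ((f (y, 0) :: ·) '' S' y) := fun y =>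
    finFib_image (w' y) w _ _ (e y) (hw0 y) (hfin y)
  have key : gf w S = ∑ y, X ^ e y * gf (w' y) (S' y) + X ^ s * gf w S := by
    conv_lhs => rw [hsplit]
    rw [gf_union _ _ _ (finFib_biUnion _ _ _ hf0) (finFib_image w w _ _ s hwb hS),
      gf_image w w _ _ s (bump_injective f).injOn hwb, gf_biUnion _ _ _ hf0]
    · congr 1
      refine Finset.sum_congr rfl fun y _ => ?_
      exact gf_image (w' y) w _ _ (e y) (by intro a _ b _ h; simpa using h) (hw0 y)
    · intro y y' hy
      rw [Set.disjoint_left]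
      rintro _ ⟨l, -, rfl⟩ ⟨l', -, h⟩
      simp only [List.cons.injEq, EmbeddingLike.apply_eq_iff_eq, Prod.mk.injEq] at h
      exact hy h.1.1.symm
    · rw [Set.disjoint_left]
      rintro l hl ⟨l', hl', rfl⟩
      simp only [Set.mem_iUnion] at hl
      obtain ⟨y, -, l, -, h⟩ := hl
      match l', h with
      | b :: l', h =>
        simp [bump] at h
  linear_combination key

end cons

/-! ### Exponents and finite products -/

/-- The exponent `(i - j + 1).choose 2`, as a natural number. -/
def diffChoose : ℕ → ℕ → ℕ
  | i, 0 => (i + 1).choose 2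
  | 0, j + 1 => (j + 1).choose 2
  | i + 1, j + 1 => diffChoose i j

/-- With `d = i - j - 1` in the integers, the exponent is `d (d + 1) / 2`, which is invariant under
replacing `d` by `-1 - d`. -/
theorem diffChoose_succ_right (i j : ℕ) : diffChoose i (j + 1) = diffChoose j i := by
  induction i generalizing j with
  | zero => simp [diffChoose]
  | succ i ih =>
    cases j with
    | zero => cases i <;> simp [diffChoose]
    | succ j => rw [diffChoose, diffChoose, ih]

theorem diffChoose_add (i j : ℕ) : diffChoose i j + j = diffChoose j i + i := by
  induction i generalizing j with
  | zero =>
    cases j with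
    | zero => rfl
    | succ j => simp [diffChoose, Nat.choose_succ_succ j.succ 1]; ring
  | succ i ih =>
    cases j with
    | zero => simp [diffChoose, Nat.choose_succ_succ i.succ 1]; ring
    | succ j => have := ih j; simp only [diffChoose]; omega

/-- The expansion of `(i - j)(i - j + 1) / 2`, with every term moved to a side where it is positive;
it matches the monomials of the two sides at the end. -/
theorem diffChoose_eq (i j : ℕ) :
    diffChoose i j + i * j + (j + 1).choose 2 + j = (i + 1).choose 2 + j * (j + 1) := by
  induction i generalizing j with
  | zero =>
    cases j with
    | zero => rfl
    | succ j =>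
      have h := Nat.choose_succ_succ (j + 1) 1
      have h2 : (j + 1).choose 2 * 2 = (j + 1) * j := by
        rw [Nat.choose_two_right]; exact Nat.div_mul_cancel (Nat.even_mul_pred_self _).two_dvd
      simp only [diffChoose]
      simp only [Nat.succ_eq_add_one, Nat.reduceAdd, Nat.choose_one_right] at h
      simp [h]
      nlinarith
  | succ i ih =>
    cases j with
    | zero => simp [diffChoose]
    | succ j =>
      have := ih j
      have h := Nat.choose_succ_succ (j + 1) 1
      have h' := Nat.choose_succ_succ (i + 1) 1
      simp only [diffChoose]
      simp only [Nat.succ_eq_add_one, Nat.reduceAdd, Nat.choose_one_right] at h h'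
      rw [h, h']
      nlinarith

/-- The product `(1 - X) (1 - X ^ 2) ⋯ (1 - X ^ n)`. -/
noncomputable def qPoch (n : ℕ) : ℤ⟦X⟧ := ∏ m ∈ range n, (1 - X ^ (m + 1))

/-- The product `(1 - X ^ 2) (1 - X ^ 4) ⋯ (1 - X ^ (2 * n))`. -/
noncomputable def qPochSq (n : ℕ) : ℤ⟦X⟧ := ∏ m ∈ range n, (1 - X ^ (2 * (m + 1)))

/-- The product `(1 + X) (1 + X ^ 2) ⋯ (1 + X ^ n)`. -/
noncomputable def qPochNeg (n : ℕ) : ℤ⟦X⟧ := ∏ m ∈ range n, (1 + X ^ (m + 1))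

theorem qPoch_succ (n : ℕ) : qPoch (n + 1) = qPoch n * (1 - X ^ (n + 1)) := prod_range_succ ..

theorem qPochSq_succ (n : ℕ) : qPochSq (n + 1) = qPochSq n * (1 - X ^ (2 * (n + 1))) :=
  prod_range_succ ..

theorem qPochNeg_succ (n : ℕ) : qPochNeg (n + 1) = qPochNeg n * (1 + X ^ (n + 1)) :=
  prod_range_succ ..

theorem qPochSq_eq (n : ℕ) : qPochSq n = qPoch n * qPochNeg n := by
  rw [qPochSq, qPoch, qPochNeg, ← prod_mul_distrib]
  refine prod_congr rfl fun m _ => ?_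
  ring

theorem one_sub_X_pow_ne_zero {n : ℕ} (hn : 0 < n) : (1 - X ^ n : ℤ⟦X⟧) ≠ 0 := by
  intro h
  have := congrArg constantCoeff h
  simp [hn.ne'] at this

theorem one_add_X_pow_ne_zero (n : ℕ) : (1 + X ^ n : ℤ⟦X⟧) ≠ 0 := by
  intro h
  have := congrArg constantCoeff h
  rcases n.eq_zero_or_pos with rfl | hn
  · simp at this
  · simp [hn.ne'] at this

theorem qPoch_ne_zero (n : ℕ) : qPoch n ≠ 0 :=
  prod_ne_zero_iff.2 fun _ _ => one_sub_X_pow_ne_zero (by omega)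

theorem qPochSq_ne_zero (n : ℕ) : qPochSq n ≠ 0 :=
  prod_ne_zero_iff.2 fun _ _ => one_sub_X_pow_ne_zero (by omega)

/-- The generating function, by sum of the overlined positions, of the overlinings of `s` parts
in which `k` parts are plain and the parts in positions `> s - t` are overlined. -/
noncomputable def overlineGF : ℕ → ℕ → ℕ → ℤ⟦X⟧
  | 0, _, 0 => 1
  | 0, _, _ + 1 => 0
  | s + 1, t + 1, k => X ^ (s + 1) * overlineGF s t k
  | s + 1, 0, 0 => X ^ (s + 1) * overlineGF s 0 0
  | s + 1, 0, k + 1 => X ^ (s + 1) * overlineGF s 0 (k + 1) + overlineGF s 0 k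

/-- The `t` forced overlines occupy the positions `i + 1, …, i + t`, whose sum is the exponent. -/
theorem overlineGF_add (i t k : ℕ) :
    overlineGF (i + t) t k = X ^ (i * t + (t + 1).choose 2) * overlineGF i 0 k := by
  induction t with
  | zero => simp
  | succ t ih =>
    rw [← add_assoc, overlineGF, ih, ← mul_assoc, ← pow_add]
    congr 2
    have h := Nat.choose_succ_succ (t + 1) 1
    simp only [Nat.succ_eq_add_one, Nat.reduceAdd, Nat.choose_one_right] at h
    rw [h]; ring

/-- `A z` are the generating functions of the sets of `z` positive integers; the sum of all `A z`
does not change when the elements are required to exceed `N` and multiples of sets of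
`{1, …, N}` are put back. -/
theorem X_pow_dvd_sum_sub {A : ℕ → ℤ⟦X⟧}
    (hA : ∀ z, A (z + 1) * (1 - X ^ (z + 1)) = X ^ (z + 1) * A z) (K N : ℕ) :
    X ^ K ∣ ∑ z ∈ range K, A z - qPochNeg N * ∑ z ∈ range K, X ^ (z * N) * A z := by
  -- By `hA`, `X ^ (z * N) * A z * (1 - X ^ z)` is `X ^ (N + 1)` times the term of index `z - 1` of
  -- the second sum, so the difference telescopes. Only the top term survives, and its exponent `(K
  -- + 1) * (N + 1)` is at least `K + 1`.
  have step : ∀ K N : ℕ, X ^ (N + 1) * (X ^ (K * (N + 1)) * A K) +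
      (∑ z ∈ range (K + 1), X ^ (z * N) * A z -
        (1 + X ^ (N + 1)) * ∑ z ∈ range (K + 1), X ^ (z * (N + 1)) * A z) = 0 := by
    intro K N
    induction K with
    | zero => simp; ring
    | succ K ih =>
      rw [sum_range_succ, sum_range_succ _ (K + 1)]
      linear_combination ih + X ^ ((K + 1) * N) * hA K
  induction N with
  | zero => simp [qPochNeg]
  | succ N ih =>
    cases K with
    | zero => simp
    | succ K =>
      have h2 : (∑ z ∈ range (K + 1), A z -
          qPochNeg (N + 1) * ∑ z ∈ range (K + 1), X ^ (z * (N + 1)) * A z : ℤ⟦X⟧) =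
          (∑ z ∈ range (K + 1), A z - qPochNeg N * ∑ z ∈ range (K + 1), X ^ (z * N) * A z) -
            X ^ (K + 1) * (X ^ (N + K * N) * qPochNeg N * A K) := by
        rw [qPochNeg_succ]
        linear_combination qPochNeg N * step K N
      rw [h2]
      exact dvd_sub ih (dvd_mul_right _ _)

/-! ### The generating function of slack lists -/

/-- The least slack between heights of a part with residue `x` and the next one, of residue `p`. -/
def minGap (x p : Fin 3) : ℕ := if x = 0 ∨ x.val + p.val = 3 then 0 else 1

/-- A list of triples (residue, overlined, slack) encodes a jagged overpartition, smallest part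
first. This is the sum of the heights of the parts, over a part of residue `p` and height `0`. -/
def gapWeight : Fin 3 → List ((Fin 3 × Bool) × ℕ) → ℕ
  | _, [] => 0
  | p, ((x, c), g) :: l => (l.length + 1) * (minGap x p + c.toNat + g) + gapWeight x l

/-- The lists with `n x` entries of residue `x`, and `k` plain entries, none of them among the
first `t`. -/
def gapSet (n : Fin 3 → ℕ) (t k : ℕ) : Set (List ((Fin 3 × Bool) × ℕ)) :=
  {l | (∀ x, l.countP (fun a => a.1.1 = x) = n x) ∧ l.countP (fun a => a.1.2 = false) = k ∧
    t ≤ l.length ∧ ∀ a ∈ l.take t, a.1.2 = true}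

theorem length_eq_of_countP (l : List ((Fin 3 × Bool) × ℕ)) (n : Fin 3 → ℕ)
    (h : ∀ x, l.countP (fun a => a.1.1 = x) = n x) : l.length = n 0 + n 1 + n 2 := by
  rw [← h 0, ← h 1, ← h 2]
  clear h
  induction l with
  | nil => rfl
  | cons a l ih =>
    obtain ⟨⟨x, c⟩, g⟩ := a
    simp only [List.countP_cons, List.length_cons, ih]
    fin_cases x <;> simp <;> ring

/-- One more entry of residue `x`. -/
def incr (x : Fin 3) (n : Fin 3 → ℕ) : Fin 3 → ℕ := fun y => if y = x then n y + 1 else n y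

theorem exists_incr {x : Fin 3} {n : Fin 3 → ℕ} (h : n x ≠ 0) : ∃ n', n = incr x n' := by
  refine ⟨fun y => if y = x then n y - 1 else n y, ?_⟩
  funext y
  by_cases hy : y = x
  · subst hy; simp only [incr, reduceIte]; omega
  · simp [incr, hy]

theorem countP_cons_incr (x : Fin 3) (c : Bool) (g : ℕ) (l : List ((Fin 3 × Bool) × ℕ))
    (n : Fin 3 → ℕ) :
    (∀ y, (((x, c), g) :: l).countP (fun a => a.1.1 = y) = incr x n y) ↔
      ∀ y, l.countP (fun a => a.1.1 = y) = n y := by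
  refine forall_congr' fun y => ?_
  simp only [List.countP_cons, incr, decide_eq_true_eq]
  by_cases h : y = x
  · simp [h]
  · simp [h, Ne.symm h]

theorem cons_true_mem_gapSet (x : Fin 3) (g : ℕ) (l : List ((Fin 3 × Bool) × ℕ))
    (n : Fin 3 → ℕ) (t k : ℕ) :
    ((x, true), g) :: l ∈ gapSet (incr x n) t k ↔ l ∈ gapSet n (t - 1) k := by
  simp only [gapSet, Set.mem_ofPred_eq, countP_cons_incr]
  cases t <;> simp

theorem cons_false_mem_gapSet (x : Fin 3) (g : ℕ) (l : List ((Fin 3 × Bool) × ℕ))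
    (n : Fin 3 → ℕ) (k : ℕ) :
    ((x, false), g) :: l ∈ gapSet (incr x n) 0 (k + 1) ↔ l ∈ gapSet n 0 k := by
  simp only [gapSet, Set.mem_ofPred_eq, countP_cons_incr]
  simp

theorem cons_false_notMem_gapSet (x : Fin 3) (g : ℕ) (l : List ((Fin 3 × Bool) × ℕ))
    (n : Fin 3 → ℕ) (t k : ℕ) (h : t ≠ 0 ∨ k = 0) :
    ((x, false), g) :: l ∉ gapSet n t k := by
  rintro ⟨-, h2, h3, h4⟩
  rcases h with h | rfl
  · cases t with
    | zero => exact h rfl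
    | succ t => simpa using h4 ((x, false), g) (by simp)
  · simp at h2

theorem cons_notMem_gapSet (x : Fin 3) (c : Bool) (g : ℕ) (l : List ((Fin 3 × Bool) × ℕ))
    (n : Fin 3 → ℕ) (t k : ℕ) (h : n x = 0) : ((x, c), g) :: l ∉ gapSet n t k := by
  rintro ⟨h1, -⟩
  have := h1 x
  simp [h] at this

/-- The denominator of the generating function of `gapSet n t k`. -/
noncomputable def gapDenom (n : Fin 3 → ℕ) : ℤ⟦X⟧ :=
  qPoch (n 0) * qPoch (n 1 + n 2) * qPochSq (n 1) * qPochSq (n 2)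

/-- The part of the numerator of the generating function of `gapSet n t k` that depends on the
residue of the preceding part. -/
noncomputable def gapNum (p : Fin 3) (n : Fin 3 → ℕ) : ℤ⟦X⟧ :=
  match p with
  | 0 => X ^ (diffChoose (n 1) (n 2) + 2 * n 2) + X ^ (diffChoose (n 2) (n 1) + 2 * n 1)
  | 1 => X ^ diffChoose (n 1) (n 2) * (1 + X ^ (n 1 + n 2))
  | 2 => X ^ diffChoose (n 2) (n 1) * (1 + X ^ (n 1 + n 2))

/-- The closed form of the generating function of `gapSet n t k` over residue `p`. -/
def GapFormula (p : Fin 3) (n : Fin 3 → ℕ) (t k : ℕ) (s : ℕ) (G : ℤ⟦X⟧) : Prop :=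
  G * gapDenom n * (1 + X ^ (n 1 + n 2)) =
    gapNum p n * qPochSq (n 1 + n 2) * overlineGF s t k

/-- The generating function of the lists with head of residue `x` and slack `0`, but for the
contribution of `minGap`. -/
noncomputable def headGF (x : Fin 3) (n : Fin 3 → ℕ) (t k s : ℕ) : ℤ⟦X⟧ :=
  X ^ s * gf (gapWeight x) {l | ((x, true), 0) :: l ∈ gapSet n t k} +
    gf (gapWeight x) {l | ((x, false), 0) :: l ∈ gapSet n t k}

theorem headGF_eq_zero {x : Fin 3} {n : Fin 3 → ℕ} {t k s : ℕ} (h : n x = 0) :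
    headGF x n t k s = 0 := by
  have : ∀ c, {l | ((x, c), 0) :: l ∈ gapSet n t k} = ∅ := fun c =>
    Set.eq_empty_of_forall_notMem fun l => cons_notMem_gapSet x c 0 l n t k h
  simp [headGF, this, gf_empty]

/-- Removing a head of residue `x` leaves a list over residue `x`. Whether that head is overlined
affects only the recursion of `overlineGF`, so the residue part of the formula is carried along
unchanged. -/
theorem headGF_incr {x : Fin 3} {n : Fin 3 → ℕ} {t k s : ℕ} (ht : t ≤ s + 1)
    (ih : ∀ t k, t ≤ s → GapFormula x n t k s (gf (gapWeight x) (gapSet n t k))) :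
    GapFormula x n t k (s + 1) (headGF x (incr x n) t k (s + 1)) := by
  unfold GapFormula at ih ⊢
  -- At `t = 0` the truncated `t - 1` is 0, as it should be: no overline was forced and none is.
  have h1 : {l | ((x, true), 0) :: l ∈ gapSet (incr x n) t k} = gapSet n (t - 1) k :=
    Set.ext fun l => cons_true_mem_gapSet x 0 l n t k
  rw [headGF, h1]
  have h0 : t ≠ 0 ∨ k = 0 → {l | ((x, false), 0) :: l ∈ gapSet (incr x n) t k} = ∅ := fun h =>
    Set.eq_empty_of_forall_notMem fun l => cons_false_notMem_gapSet x 0 l _ t k h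
  match t, k with
  | t + 1, k =>
    rw [h0 (by simp), gf_empty, overlineGF, Nat.add_sub_cancel]
    linear_combination X ^ (s + 1) * ih t k (by omega)
  | 0, 0 =>
    rw [h0 (by simp), gf_empty, overlineGF]
    linear_combination X ^ (s + 1) * ih 0 0 (by omega)
  | 0, k + 1 =>
    have h2 : {l | ((x, false), 0) :: l ∈ gapSet (incr x n) 0 (k + 1)} = gapSet n 0 k :=
      Set.ext fun l => cons_false_mem_gapSet x 0 l n k
    rw [h2, overlineGF]
    linear_combination X ^ (s + 1) * ih 0 (k + 1) (by omega) + ih 0 k (by omega)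

section head
variable {n : Fin 3 → ℕ} {t k s : ℕ} (hn : n 0 + n 1 + n 2 = s + 1) (ht : t ≤ s + 1)
  (ih : ∀ (n : Fin 3 → ℕ), n 0 + n 1 + n 2 = s → ∀ p t k, t ≤ s →
    GapFormula p n t k s (gf (gapWeight p) (gapSet n t k)))
include hn ht ih

theorem headGF_zero : headGF 0 n t k (s + 1) * gapDenom n * (1 + X ^ (n 1 + n 2)) =
    (1 - X ^ n 0) * gapNum 0 n * qPochSq (n 1 + n 2) * overlineGF (s + 1) t k := by
  by_cases h : n 0 = 0
  · rw [headGF_eq_zero h, h]; simp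
  · obtain ⟨m, rfl⟩ := exists_incr h
    have := headGF_incr (k := k) ht (ih m (by simp [incr] at hn; omega) 0)
    simp only [GapFormula, gapDenom, gapNum, incr] at this ⊢
    simp only [Fin.isValue, reduceIte, one_ne_zero, Fin.reduceEq, qPoch_succ] at this ⊢
    linear_combination (1 - X ^ (m 0 + 1)) * this

theorem headGF_one : headGF 1 n t k (s + 1) * gapDenom n * (1 + X ^ (n 1 + n 2)) =
    (1 - X ^ (2 * n 1)) * X ^ diffChoose (n 2) (n 1) * qPochSq (n 1 + n 2) *
      overlineGF (s + 1) t k := by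
  by_cases h : n 1 = 0
  · rw [headGF_eq_zero h, h]; simp
  · obtain ⟨m, rfl⟩ := exists_incr h
    have := headGF_incr (k := k) ht (ih m (by simp [incr] at hn; omega) 1)
    simp only [GapFormula, gapDenom, gapNum, incr] at this ⊢
    simp only [Fin.isValue, reduceIte, zero_ne_one, Fin.reduceEq, add_right_comm _ 1,
      qPoch_succ, qPochSq_succ, diffChoose_succ_right] at this ⊢
    -- `gapNum 1 m` contains the factor `1 + X ^ (m 1 + m 2)` of the left side of `GapFormula`, so
    -- it can be cancelled.
    refine mul_right_cancel₀ (one_add_X_pow_ne_zero (m 1 + m 2)) ?_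
    linear_combination (1 - X ^ (m 1 + m 2 + 1)) * (1 - X ^ (2 * (m 1 + 1))) *
      (1 + X ^ (m 1 + m 2 + 1)) * this

theorem headGF_two : headGF 2 n t k (s + 1) * gapDenom n * (1 + X ^ (n 1 + n 2)) =
    (1 - X ^ (2 * n 2)) * X ^ diffChoose (n 1) (n 2) * qPochSq (n 1 + n 2) *
      overlineGF (s + 1) t k := by
  by_cases h : n 2 = 0
  · rw [headGF_eq_zero h, h]; simp
  · obtain ⟨m, rfl⟩ := exists_incr h
    have := headGF_incr (k := k) ht (ih m (by simp [incr] at hn; omega) 2)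
    simp only [GapFormula, gapDenom, gapNum, incr] at this ⊢
    simp only [Fin.isValue, reduceIte, Fin.reduceEq, ← add_assoc,
      qPoch_succ, qPochSq_succ, diffChoose_succ_right] at this ⊢
    refine mul_right_cancel₀ (one_add_X_pow_ne_zero (m 1 + m 2)) ?_
    linear_combination (1 - X ^ (m 1 + m 2 + 1)) * (1 - X ^ (2 * (m 2 + 1))) *
      (1 + X ^ (m 1 + m 2 + 1)) * this

end head

theorem length_of_mem_gapSet {n : Fin 3 → ℕ} {t k : ℕ} {l} (h : l ∈ gapSet n t k) :
    l.length = n 0 + n 1 + n 2 := length_eq_of_countP l n h.1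

theorem gapSet_zero (t k : ℕ) (ht : t = 0) (n : Fin 3 → ℕ) (hn : n 0 + n 1 + n 2 = 0) :
    gapSet n t k = if k = 0 then {[]} else ∅ := by
  have hx : ∀ x, n x = 0 := by intro x; fin_cases x <;> simp <;> omega
  ext l
  constructor
  · intro h
    have hl := length_of_mem_gapSet h
    rw [hn, List.length_eq_zero_iff] at hl
    subst hl
    have : k = 0 := h.2.1.symm
    simp [this]
  · split_ifs with h
    · rintro rfl
      simp [gapSet, hx, h, ht]
    · exact fun h => h.elim

/-- All `s + 1` heights rise with the slack of the smallest part, whence the factor `1 - X ^ (s +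
1)`; `minGap` and the overline of that part are likewise multiplied by `s + 1`. -/
theorem gf_gapSet_succ {s : ℕ} (p : Fin 3) (n : Fin 3 → ℕ) (t k : ℕ)
    (hn : n 0 + n 1 + n 2 = s + 1)
    (hfin : ∀ (n : Fin 3 → ℕ), n 0 + n 1 + n 2 = s → ∀ p t k,
      FinFib (gapWeight p) (gapSet n t k)) :
    FinFib (gapWeight p) (gapSet n t k) ∧
    gf (gapWeight p) (gapSet n t k) * (1 - X ^ (s + 1)) =
      ∑ x, X ^ ((s + 1) * minGap x p) * headGF x n t k (s + 1) := by
  have hnil : [] ∉ gapSet n t k := fun h => by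
    have := length_of_mem_gapSet h
    simp at this; omega
  have hmem : ∀ y g l, Equiv.refl ((Fin 3 × Bool) × ℕ) (y, g) :: l ∈ gapSet n t k ↔
      l ∈ {l | (y, 0) :: l ∈ gapSet n t k} := by
    intro y g l
    simp only [gapSet, Set.mem_ofPred_eq, List.countP_cons, Equiv.refl_apply]
    cases t <;> simp
  have hw : ∀ (y : Fin 3 × Bool) g l, l ∈ {l | (y, 0) :: l ∈ gapSet n t k} →
      gapWeight p (Equiv.refl ((Fin 3 × Bool) × ℕ) (y, g) :: l) =
        (s + 1) * g + (s + 1) * (minGap y.1 p + y.2.toNat) + gapWeight y.1 l := by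
    rintro ⟨x, c⟩ g l hl
    have := length_of_mem_gapSet hl
    rw [List.length_cons, hn] at this
    simp only [Equiv.refl_apply, gapWeight, this]; ring
  have hf : ∀ y : Fin 3 × Bool,
      FinFib (gapWeight y.1) {l | (y, 0) :: l ∈ gapSet n t k} := by
    rintro ⟨x, c⟩
    by_cases h : n x = 0
    · have : {l | ((x, c), 0) :: l ∈ gapSet n t k} = ∅ :=
        Set.eq_empty_of_forall_notMem fun l => cons_notMem_gapSet x c 0 l n t k h
      rw [this]; exact finFib_empty _
    · obtain ⟨m, rfl⟩ := exists_incr h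
      have hm : m 0 + m 1 + m 2 = s := by
        fin_cases x <;> simp [incr] at hn <;> omega
      cases c with
      | true =>
        simp only [cons_true_mem_gapSet]
        exact hfin m hm x _ _
      | false =>
        by_cases h : t ≠ 0 ∨ k = 0
        · have : {l | ((x, false), 0) :: l ∈ gapSet (incr x m) t k} = ∅ :=
            Set.eq_empty_of_forall_notMem fun l => cons_false_notMem_gapSet x 0 l _ t k h
          rw [this]; exact finFib_empty _
        · push Not at h
          obtain ⟨rfl, hk⟩ := h
          obtain ⟨k, rfl⟩ := Nat.exists_eq_succ_of_ne_zero hk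
          simp only [Nat.succ_eq_add_one, cons_false_mem_gapSet]
          exact hfin m hm x _ _
  refine ⟨finFib_cons _ _ _ _ _ _ (s + 1) (by omega) hnil hmem hw hf, ?_⟩
  rw [gf_cons _ _ _ _ _ _ (s + 1) (by omega) hnil hmem hw hf, Fintype.sum_prod_type]
  refine Finset.sum_congr rfl fun x _ => ?_
  simp only [Fintype.sum_bool, headGF, Bool.toNat_true, Bool.toNat_false]
  ring

/-- Induction on the number of parts, simultaneously for all preceding residues `p`, since the
recursion mixes them. The factor `1 + X ^ (n 1 + n 2)` stays on the left because it is not an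
explicit factor of `gapNum 0`. -/
theorem gf_gapSet (s : ℕ) : ∀ (n : Fin 3 → ℕ), n 0 + n 1 + n 2 = s →
    (∀ p t k, FinFib (gapWeight p) (gapSet n t k)) ∧
    ∀ p t k, t ≤ s → GapFormula p n t k s (gf (gapWeight p) (gapSet n t k)) := by
  induction s with
  | zero =>
    intro n hn
    constructor
    · intro p t k m
      refine (Set.finite_singleton []).subset ?_
      rintro l ⟨hl, -⟩
      have := length_of_mem_gapSet hl
      rw [hn, List.length_eq_zero_iff] at this
      exact this
    · intro p t k ht
      obtain ⟨h0, h1, h2⟩ : n 0 = 0 ∧ n 1 = 0 ∧ n 2 = 0 := by omega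
      rw [gapSet_zero t k (by omega) n hn]
      have hnum : gapNum p n = 1 + 1 := by
        fin_cases p <;> simp [gapNum, h1, h2, diffChoose]
      rw [GapFormula, hnum]
      cases k with
      | zero =>
        simp [gf_singleton, gapWeight, gapDenom, h0, h1, h2, overlineGF, qPoch, qPochSq]
      | succ k => simp [gf_empty, overlineGF]
  | succ s ih =>
    intro n hn
    have hrec := fun p t k => gf_gapSet_succ p n t k hn fun n hn => (ih n hn).1
    refine ⟨fun p t k => (hrec p t k).1, fun p t k ht => ?_⟩
    have ih' := fun n hn => (ih n hn).2
    have e0 := headGF_zero (k := k) hn ht ih'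
    have e1 := headGF_one (k := k) hn ht ih'
    have e2 := headGF_two (k := k) hn ht ih'
    have e := (hrec p t k).2
    rw [Fin.sum_univ_three] at e
    refine mul_right_cancel₀ (one_sub_X_pow_ne_zero s.succ_pos) ?_
    have hX : (X ^ (s + 1) : ℤ⟦X⟧) = X ^ n 0 * X ^ n 1 * X ^ n 2 := by
      rw [← hn]; ring
    -- With `x0`, `x1`, `x2` standing for `X ^ n 0`, `X ^ n 1`, `X ^ n 2`, the recursion is a
    -- polynomial identity modulo this single relation `u * x2 = v * x1`.
    have huv : (X ^ diffChoose (n 1) (n 2) * X ^ n 2 : ℤ⟦X⟧) =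
        X ^ diffChoose (n 2) (n 1) * X ^ n 1 := by
      rw [← pow_add, ← pow_add, diffChoose_add]
    have hg : ∀ x : Fin 3, (X ^ ((s + 1) * minGap x p) : ℤ⟦X⟧) =
        (X ^ (s + 1)) ^ minGap x p := fun x => pow_mul _ _ _
    simp only [hg] at e
    simp only [Nat.succ_eq_add_one]
    rw [hX] at e ⊢
    generalize hu : (X ^ diffChoose (n 1) (n 2) : ℤ⟦X⟧) = u at *
    generalize hv : (X ^ diffChoose (n 2) (n 1) : ℤ⟦X⟧) = v at *
    set G := gf (gapWeight p) (gapSet n t k)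
    set H0 := headGF 0 n t k (s + 1)
    set H1 := headGF 1 n t k (s + 1)
    set H2 := headGF 2 n t k (s + 1)
    simp only [gapNum, pow_add, two_mul, hu, hv] at e0 e1 e2 ⊢
    set D := gapDenom n
    set R := qPochSq (n 1 + n 2)
    set O := overlineGF (s + 1) t k
    set x0 : ℤ⟦X⟧ := X ^ n 0
    set x1 : ℤ⟦X⟧ := X ^ n 1
    set x2 : ℤ⟦X⟧ := X ^ n 2
    fin_cases p
    · simp [minGap] at e
      simp only
      linear_combination D * (1 + x1 * x2) * e + e0 + x0 * x1 * x2 * (e1 + e2) +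
        x0 * (x1 - x2) * R * O * huv
    · simp [minGap] at e
      simp only
      linear_combination D * (1 + x1 * x2) * e + e0 + x0 * x1 * x2 * e1 + e2 +
        (-x1 - x0 * x2 + x0 * x1 + x0 * x1 * x2 * x1) * R * O * huv
    · simp [minGap] at e
      simp only
      linear_combination D * (1 + x1 * x2) * e + e0 + x0 * x1 * x2 * e2 + e1 -
        (-x2 - x0 * x1 + x0 * x2 + x0 * x1 * x2 * x2) * R * O * huv

/-! ### Jagged overpartitions as slack lists -/

/-- The residue of a part modulo `3`. -/
def OverPart.residue (a : OverPart) : Fin 3 := ⟨a.size % 3, Nat.mod_lt _ (by norm_num)⟩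

/-- The height of a part: a third of its size, rounded up. -/
def OverPart.height (a : OverPart) : ℕ := (a.size + 2) / 3

/-- The amount by which a size congruent to `x` falls short of a multiple of `3`. -/
def shortfall (x : Fin 3) : ℕ := (3 - x.val) % 3

/-- The jagged overpartition, smallest part first, with a given list of slacks. -/
def decode : Fin 3 → ℕ → List ((Fin 3 × Bool) × ℕ) → List OverPart
  | _, _, [] => []
  | p, h, ((x, c), g) :: l =>
    ⟨3 * (h + minGap x p + c.toNat + g) - shortfall x, c⟩ ::
      decode x (h + minGap x p + c.toNat + g) l

/-- The list of slacks of a jagged overpartition, smallest part first. -/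
def encode : Fin 3 → ℕ → List OverPart → List ((Fin 3 × Bool) × ℕ)
  | _, _, [] => []
  | p, h, a :: L =>
    ((a.residue, a.overlined), a.height - (h + minGap a.residue p + a.overlined.toNat)) ::
      encode a.residue a.height L

/-- The slacks of the list are nonnegative, and the parts are positive. -/
def GapChain : Fin 3 → ℕ → List OverPart → Prop
  | _, _, [] => True
  | p, h, a :: L => 0 < a.size ∧ h + minGap a.residue p + a.overlined.toNat ≤ a.height ∧
      GapChain a.residue a.height L

/-- The first part of the decoded list is positive. -/
def HeadPos : Fin 3 → ℕ → List ((Fin 3 × Bool) × ℕ) → Prop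
  | _, _, [] => True
  | p, h, ((x, c), g) :: _ => 0 < h + minGap x p + c.toNat + g

theorem headPos_of_pos {p : Fin 3} {h : ℕ} (hh : 0 < h) (l) : HeadPos p h l := by
  match l with
  | [] => trivial
  | ((x, c), g) :: l => simp only [HeadPos]; omega

theorem residue_mk {h : ℕ} (hh : 0 < h) (x : Fin 3) (c : Bool) :
    OverPart.residue ⟨3 * h - shortfall x, c⟩ = x := by
  rw [Fin.ext_iff]
  simp only [OverPart.residue, shortfall]
  omega

theorem height_mk {h : ℕ} (x : Fin 3) (c : Bool) :
    OverPart.height ⟨3 * h - shortfall x, c⟩ = h := by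
  simp only [OverPart.height, shortfall]
  omega

theorem size_eq (a : OverPart) : a.size = 3 * a.height - shortfall a.residue := by
  simp only [OverPart.height, OverPart.residue, shortfall]
  omega

theorem decode_encode {p : Fin 3} {h : ℕ} {L : List OverPart} (hL : GapChain p h L) :
    decode p h (encode p h L) = L := by
  induction L generalizing p h with
  | nil => rfl
  | cons a L ih =>
    obtain ⟨h1, h2, h3⟩ := hL
    have : h + minGap a.residue p + a.overlined.toNat +
        (a.height - (h + minGap a.residue p + a.overlined.toNat)) = a.height := by omega
    simp only [encode, decode, this]
    rw [ih h3, ← size_eq]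

theorem encode_decode {p : Fin 3} {h : ℕ} {l} (hl : HeadPos p h l) :
    encode p h (decode p h l) = l := by
  induction l generalizing p h with
  | nil => rfl
  | cons a l ih =>
    obtain ⟨⟨x, c⟩, g⟩ := a
    simp only [HeadPos] at hl
    simp only [encode, decode, residue_mk hl, height_mk]
    rw [ih (headPos_of_pos hl l)]
    simp

theorem gapChain_decode {p : Fin 3} {h : ℕ} {l} (hl : HeadPos p h l) :
    GapChain p h (decode p h l) := by
  induction l generalizing p h with
  | nil => trivial
  | cons a l ih =>
    obtain ⟨⟨x, c⟩, g⟩ := a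
    simp only [HeadPos] at hl
    simp only [GapChain, decode, residue_mk hl, height_mk]
    refine ⟨?_, by omega, ih (headPos_of_pos hl l)⟩
    simp only [shortfall]
    omega

theorem map_fst_encode (p : Fin 3) (h : ℕ) (L : List OverPart) :
    (encode p h L).map Prod.fst = L.map fun a => (a.residue, a.overlined) := by
  induction L generalizing p h with
  | nil => rfl
  | cons a L ih => simp [encode, ih]

theorem length_encode (p : Fin 3) (h : ℕ) (L : List OverPart) :
    (encode p h L).length = L.length := by
  simpa using congrArg List.length (map_fst_encode p h L)

theorem gapWeight_encode {p : Fin 3} {h : ℕ} {L : List OverPart} (hL : GapChain p h L) :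
    gapWeight p (encode p h L) + h * L.length = (L.map OverPart.height).sum := by
  induction L generalizing p h with
  | nil => simp [encode, gapWeight]
  | cons a L ih =>
    obtain ⟨h1, h2, h3⟩ := hL
    have := ih h3
    obtain ⟨d, hd⟩ := Nat.exists_eq_add_of_le h2
    simp only [encode, gapWeight, List.length_cons, List.map_cons, List.sum_cons, length_encode]
    rw [← this, hd, Nat.add_sub_cancel_left]
    ring

theorem sum_height (L : List OverPart) : 3 * (L.map OverPart.height).sum =
    (L.map OverPart.size).sum + 2 * numMod3 1 L + numMod3 2 L := by
  induction L with
  | nil => rfl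
  | cons a L ih =>
    simp only [numMod3, Nat.ModEq] at ih
    have h : a.size % 3 = 0 ∨ a.size % 3 = 1 ∨ a.size % 3 = 2 := by omega
    rcases h with h | h | h <;>
      simp [numMod3, Nat.ModEq, mul_add, ih, OverPart.height, h] <;> omega

theorem countP_residue (x : Fin 3) (L : List OverPart) :
    L.countP (fun a => a.residue = x) = numMod3 x L := by
  refine List.countP_congr fun a _ => ?_
  simp only [decide_eq_true_eq, Fin.ext_iff, OverPart.residue, Nat.ModEq,
    Nat.mod_eq_of_lt x.isLt]

theorem encode_mem_gapSet {p : Fin 3} {h : ℕ} {L : List OverPart} {n : Fin 3 → ℕ} {t k : ℕ} :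
    encode p h L ∈ gapSet n t k ↔ (∀ x : Fin 3, numMod3 x L = n x) ∧ numPlain L = k ∧
      t ≤ L.length ∧ ∀ a ∈ L.take t, a.overlined = true := by
  have e := map_fst_encode p h L
  have h1 : ∀ x, (encode p h L).countP (fun a => a.1.1 = x) = numMod3 x L := fun x => by
    have := congrArg (List.countP fun b : Fin 3 × Bool => b.1 = x) e
    rw [List.countP_map, List.countP_map] at this
    rw [← countP_residue]; exact this
  have h2 : (encode p h L).countP (fun a => a.1.2 = false) = numPlain L := by
    have := congrArg (List.countP fun b : Fin 3 × Bool => b.2 = false) e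
    rw [List.countP_map, List.countP_map] at this
    exact this
  have h3 : (∀ a ∈ (encode p h L).take t, a.1.2 = true) ↔
      ∀ a ∈ L.take t, a.overlined = true := by
    have := congrArg (fun l => ∀ b ∈ List.take t l, Prod.snd b = true) e
    simp only [List.map_take.symm, List.forall_mem_map] at this
    exact iff_of_eq this
  simp only [gapSet, Set.mem_ofPred_eq, h1, h2, h3, length_encode]

/-- Writing each size as three times its height minus a shortfall in `{0, 1, 2}` turns the bound
into an integer bound on heights, checked residue by residue. -/
theorem minDiff_le_iff {x y : OverPart} (hx : 0 < x.size) (hy : 0 < y.size) :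
    minDiff x y ≤ (x.size : ℤ) - y.size ↔
      y.height + minGap x.residue y.residue + x.overlined.toNat ≤ x.height := by
  obtain ⟨a, c⟩ := x
  obtain ⟨b, d⟩ := y
  simp only at hx hy
  simp only [minDiff, minGap, OverPart.height, OverPart.residue, OverPart.chi, Fin.ext_iff,
    Nat.ModEq, Fin.val_zero]
  cases c <;> simp only [Bool.toNat_true, Bool.toNat_false, reduceIte, Bool.false_eq_true] <;>
    split_ifs <;> omega

theorem gapChain_iff {a : OverPart} (ha : 0 < a.size) (L : List OverPart) :
    GapChain a.residue a.height L ↔ (∀ b ∈ L, 0 < b.size) ∧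
      (a :: L).IsChain (fun y x => minDiff x y ≤ (x.size : ℤ) - y.size) := by
  induction L generalizing a with
  | nil => simp [GapChain]
  | cons b L ih =>
    by_cases hb : 0 < b.size
    · rw [GapChain, ih hb, List.isChain_cons_cons, ← minDiff_le_iff hb ha]
      simp only [List.mem_cons, forall_eq_or_imp]
      tauto
    · simp [GapChain, hb]

theorem gapChain_reverse_iff (l : List OverPart) : GapChain 1 0 l.reverse ↔
    (∀ x ∈ l, 0 < x.size) ∧ (∀ x ∈ l.getLast?, x ≠ ⟨1, true⟩) ∧
      l.IsChain (fun x y => minDiff x y ≤ (x.size : ℤ) - (y.size : ℤ)) := by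
  rw [← List.isChain_reverse, ← List.head?_reverse]
  have : (∀ x ∈ l, 0 < x.size) ↔ ∀ x ∈ l.reverse, 0 < x.size := by simp
  rw [this]
  generalize l.reverse = L
  cases L with
  | nil => simp [GapChain]
  | cons a L =>
    by_cases ha : 0 < a.size
    · rw [GapChain, gapChain_iff ha]
      -- Over the phantom part of residue 1 and height 0, an overlined part of residue 1 needs
      -- height 2, which excludes only the overlined 1; every other positive part has the required
      -- height 0 or 1.
      have : 0 + minGap a.residue 1 + a.overlined.toNat ≤ a.height ↔ a ≠ ⟨1, true⟩ := by
        obtain ⟨s, c⟩ := a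
        simp only at ha
        simp only [minGap, OverPart.height, OverPart.residue, Fin.ext_iff, Fin.val_zero,
          Fin.val_one, ne_eq, OverPart.mk.injEq]
        cases c <;> simp only [Bool.toNat_true, Bool.toNat_false, Bool.false_eq_true, and_false,
          and_true, not_false_eq_true, iff_true] <;> split_ifs <;> omega
      rw [this]
      simp only [List.mem_cons, forall_eq_or_imp, List.head?_cons, Option.mem_some_iff,
        forall_eq']
      tauto
    · simp [GapChain, ha]

/-- Heights never increase along the sequence and drop strictly after an overlined part, so its size
cannot recur. The condition is thus implied by the others. -/
theorem final_occurrence_of_isChain {l : List OverPart} (hpos : ∀ x ∈ l, 0 < x.size)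
    (h : l.IsChain (fun x y => minDiff x y ≤ (x.size : ℤ) - (y.size : ℤ))) :
    l.Pairwise (fun x y => x.overlined = true → x.size ≠ y.size) := by
  let R : OverPart → OverPart → Prop := fun x y => y.height + x.overlined.toNat ≤ x.height
  have : IsTrans OverPart R := ⟨fun x y z h1 h2 => by simp only [R] at *; omega⟩
  have hR : l.IsChain R := by
    induction l with
    | nil => exact .nil
    | cons a l ih =>
      cases l with
      | nil => exact .singleton a
      | cons b l =>
        rw [List.isChain_cons_cons] at h ⊢
        refine ⟨?_, ih (fun x hx => hpos x (List.mem_cons_of_mem _ hx)) h.2⟩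
        have := (minDiff_le_iff (hpos a (by simp)) (hpos b (by simp))).1 h.1
        simp only [R]; omega
  refine (List.isChain_iff_pairwise.1 hR).imp ?_
  intro x y hxy hx he
  simp only [R, hx, OverPart.height, he, Bool.toNat_true] at hxy
  omega

theorem lastOverlined_iff (t : ℕ) (l : List OverPart) : LastOverlined t l ↔
    t ≤ l.reverse.length ∧ ∀ x ∈ l.reverse.take t, x.overlined = true := by
  rw [LastOverlined, List.length_reverse, List.take_reverse]
  simp

theorem isJagged_iff (n : ℕ) (l : List OverPart) : IsJagged n l ↔ GapChain 1 0 l.reverse ∧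
    (l.map OverPart.size).sum = n ∧ LastOverlined (numMod3 0 l + numMod3 2 l) l := by
  rw [gapChain_reverse_iff]
  constructor
  · exact fun h => ⟨⟨h.pos, h.last_ne, h.diff⟩, h.sum_eq, h.last_overlined⟩
  · rintro ⟨⟨h1, h2, h3⟩, h4, h5⟩
    exact ⟨h1, h4, final_occurrence_of_isChain h1 h3, h2, h3, h5⟩

theorem numMod3_reverse (r : ℕ) (l : List OverPart) : numMod3 r l.reverse = numMod3 r l :=
  List.countP_reverse

/-- If `z + j > 0`, the smallest part is overlined and so has positive height; otherwise all
residues are 1 and `minGap 1 1 = 1`. Hence `gapSet` needs no positivity condition. -/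
theorem headPos_of_mem_gapSet {i j z k : ℕ} {l} (hl : l ∈ gapSet ![z, i, j] (z + j) k) :
    HeadPos 1 0 l := by
  match l with
  | [] => trivial
  | ((x, c), g) :: l =>
    obtain ⟨h1, h2, h3, h4⟩ := hl
    simp only [HeadPos]
    cases c with
    | true => simp
    | false =>
      have hzj : z + j = 0 := by
        by_contra h
        obtain ⟨t, ht⟩ := Nat.exists_eq_succ_of_ne_zero h
        rw [ht] at h4
        simpa using h4 ((x, false), g) (by simp)
      have hx := h1 x
      rw [List.countP_cons] at hx
      fin_cases x
      · simp at hx; omega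
      · simp [minGap]
      · simp at hx; omega

theorem ncard_jagged {n k i j m : ℕ} (z : ℕ) (hm : n + 2 * i + j = 3 * m) :
    {l | l ∈ jaggedSet n k i j ∧ numMod3 0 l = z}.ncard =
      (fiber (gapWeight 1) (gapSet ![z, i, j] (z + j) k) m).ncard := by
  have hb : Set.BijOn (fun l => encode 1 0 l.reverse)
      {l | l ∈ jaggedSet n k i j ∧ numMod3 0 l = z}
      (fiber (gapWeight 1) (gapSet ![z, i, j] (z + j) k) m) := by
    refine Set.InvOn.bijOn (f' := fun l => (decode 1 0 l).reverse) ⟨?_, ?_⟩ ?_ ?_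
    · rintro l ⟨⟨h, -⟩, -⟩
      simp only
      rw [decode_encode ((isJagged_iff n l).1 h).1, List.reverse_reverse]
    · rintro l ⟨h, -⟩
      simp only
      rw [List.reverse_reverse, encode_decode (headPos_of_mem_gapSet h)]
    · rintro l ⟨⟨h, h1, h2, h3⟩, h4⟩
      obtain ⟨h5, h6, h7⟩ := (isJagged_iff n l).1 h
      constructor
      · rw [encode_mem_gapSet]
        simp only [numMod3_reverse]
        rw [h4, h3, lastOverlined_iff] at h7
        refine ⟨?_, ?_, h7⟩
        · intro x
          fin_cases x
          exacts [h4, h2, h3]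
        · exact List.countP_reverse.trans h1
      · have e1 := gapWeight_encode h5
        have e2 := sum_height l.reverse
        rw [numMod3_reverse, numMod3_reverse, h2, h3, List.map_reverse (f := OverPart.size),
          List.sum_reverse, h6] at e2
        simp only
        omega
    · rintro l ⟨h, hw⟩
      have hc := gapChain_decode (headPos_of_mem_gapSet h)
      have hd := encode_decode (headPos_of_mem_gapSet h)
      rw [← hd, encode_mem_gapSet] at h
      obtain ⟨h1, h2, h3⟩ := h
      have e0 : numMod3 0 (decode 1 0 l) = z := h1 0
      have e1 : numMod3 1 (decode 1 0 l) = i := h1 1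
      have e2 : numMod3 2 (decode 1 0 l) = j := h1 2
      simp only [Set.mem_ofPred_eq, jaggedSet, isJagged_iff, numMod3_reverse,
        List.reverse_reverse, lastOverlined_iff, e0, e1, e2]
      refine ⟨⟨⟨hc, ?_, h3⟩, ?_, trivial, trivial⟩, trivial⟩
      · have e3 := gapWeight_encode hc
        have e4 := sum_height (decode 1 0 l)
        rw [hd, hw] at e3
        rw [e1, e2] at e4
        rw [List.map_reverse, List.sum_reverse]
        omega
      · exact List.countP_reverse.trans h2
  rw [← hb.image_eq, Set.InjOn.ncard_image hb.injOn]

theorem mod_of_mem_jaggedSet {n k i j : ℕ} {l} (h : l ∈ jaggedSet n k i j) :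
    ∃ m, n + 2 * i + j = 3 * m := by
  obtain ⟨h, -, h2, h3⟩ := h
  have := sum_height l
  rw [h.sum_eq, h2, h3] at this
  exact ⟨_, this.symm⟩

theorem numMod3_le_of_mem_jaggedSet {n k i j : ℕ} {l} (h : l ∈ jaggedSet n k i j) :
    numMod3 0 l ≤ n := by
  refine List.countP_le_length.trans ?_
  have := List.length_le_sum_of_one_le (l.map OverPart.size) (by
    intro m hm
    obtain ⟨x, hx, rfl⟩ := List.mem_map.1 hm
    exact h.1.pos x hx)
  rwa [h.1.sum_eq, List.length_map] at this

theorem ncard_eq_sum_fiberwise {α : Type*} {S : Set α} (hS : S.Finite) (f : α → ℕ) (K : ℕ)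
    (hf : ∀ a ∈ S, f a < K) : S.ncard = ∑ z ∈ range K, {a | a ∈ S ∧ f a = z}.ncard := by
  classical
  rw [Set.ncard_eq_toFinset_card S hS, Finset.card_eq_sum_card_fiberwise (t := range K) (f := f)]
  · refine Finset.sum_congr rfl fun z _ => ?_
    rw [← Set.ncard_coe_finset]
    congr 1
    ext a; simp
  · intro a ha
    simpa using hf a (by simpa using ha)

theorem countC_eq_sum {n k i j m K : ℕ} (hm : n + 2 * i + j = 3 * m) (hK : n < K) :
    (countC n k i j : ℤ) = ∑ z ∈ range K,
      coeff m (gf (gapWeight 1) (gapSet ![z, i, j] (z + j) k)) := by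
  rw [countC, ncard_eq_sum_fiberwise (jaggedSet_finite n k i j) (numMod3 0) K
    fun l hl => (numMod3_le_of_mem_jaggedSet hl).trans_lt hK]
  push_cast
  refine Finset.sum_congr rfl fun z _ => ?_
  rw [ncard_jagged z hm, coeff_gf]

theorem countC_eq_zero {n k i j : ℕ} (h : ∀ m, n + 2 * i + j ≠ 3 * m) : countC n k i j = 0 := by
  have : jaggedSet n k i j = ∅ := Set.eq_empty_of_forall_notMem fun l hl => by
    obtain ⟨m, hm⟩ := mod_of_mem_jaggedSet hl
    exact h m hm
  rw [countC, this, Set.ncard_empty]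

/-! ### Sets of positive integers as lists of gaps -/

/-- The increasing list of positive integers, exceeding `h`, with given differences, each of them
diminished by `1`. -/
def partialSums : ℕ → List ℕ → List ℕ
  | _, [] => []
  | h, g :: l => (h + g + 1) :: partialSums (h + g + 1) l

/-- The list of differences, each of them diminished by `1`, of a list over `h`. -/
def differences : ℕ → List ℕ → List ℕ
  | _, [] => []
  | h, a :: L => (a - h - 1) :: differences a L

/-- The sum of `partialSums 0 l`. -/
def sumWeight : List ℕ → ℕ
  | [] => 0
  | g :: l => (l.length + 1) * (g + 1) + sumWeight l

theorem length_partialSums (h : ℕ) (l : List ℕ) : (partialSums h l).length = l.length := by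
  induction l generalizing h with
  | nil => rfl
  | cons g l ih => simp [partialSums, ih]

theorem sum_partialSums (h : ℕ) (l : List ℕ) :
    (partialSums h l).sum = h * l.length + sumWeight l := by
  induction l generalizing h with
  | nil => rfl
  | cons g l ih => simp only [partialSums, List.sum_cons, ih, sumWeight, List.length_cons]; ring

theorem pairwise_partialSums (h : ℕ) (l : List ℕ) : (h :: partialSums h l).Pairwise (· < ·) := by
  rw [← List.isChain_iff_pairwise]
  induction l generalizing h with
  | nil => exact .singleton h
  | cons g l ih =>
    rw [partialSums, List.isChain_cons_cons]
    exact ⟨by omega, ih _⟩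

theorem pos_of_mem_partialSums {l : List ℕ} {x : ℕ} (hx : x ∈ partialSums 0 l) : 0 < x :=
  (List.pairwise_cons.1 (pairwise_partialSums 0 l)).1 x hx

theorem differences_partialSums (h : ℕ) (l : List ℕ) : differences h (partialSums h l) = l := by
  induction l generalizing h with
  | nil => rfl
  | cons g l ih =>
    rw [partialSums, differences, ih]
    congr 1
    omega

theorem partialSums_differences {h : ℕ} {L : List ℕ} (hL : (h :: L).Pairwise (· < ·)) :
    partialSums h (differences h L) = L := by
  rw [← List.isChain_iff_pairwise] at hL
  induction L generalizing h with
  | nil => rfl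
  | cons a L ih =>
    rw [List.isChain_cons_cons] at hL
    have : h + (a - h - 1) + 1 = a := by have := hL.1; omega
    rw [differences, partialSums, this, ih hL.2]

theorem numChanges_append (L : List ℤ) (a b : ℤ) :
    numChanges (L ++ [a] ++ [b]) = numChanges (L ++ [a]) + if a - b ≡ 3 [ZMOD 6] then 1 else 0 := by
  induction L with
  | nil => simp [numChanges]
  | cons c L ih =>
    cases L with
    | nil =>
      simp only [numChanges, List.nil_append, List.cons_append, List.tail_cons, List.zip_cons_cons,
        List.zip_nil_right, List.countP_cons, List.countP_nil] at ih ⊢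
      simp
      ring
    | cons d L =>
      simp only [numChanges, List.cons_append, List.tail_cons, List.zip_cons_cons,
        List.countP_cons] at ih ⊢
      simp only [List.append_assoc, List.cons_append, List.nil_append] at ih ⊢
      rw [ih]; ring

/-- Successive entries differ by `3 * (g + 1)`, which is 3 modulo 6 exactly for even `g`. At `h = 0`
the last entry is the phantom part `-2`. -/
theorem numChanges_partialSums (h : ℕ) (l : List ℕ) :
    numChanges ((partialSums h l).reverse.map (fun x : ℕ => 3 * (x : ℤ) - 2) ++
      [3 * (h : ℤ) - 2]) = l.countP (fun g => Even g) := by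
  induction l generalizing h with
  | nil => simp [partialSums, numChanges]
  | cons g l ih =>
    have := ih (h + g + 1)
    rw [partialSums, List.reverse_cons, List.map_append, List.map_singleton, numChanges_append,
      this, List.countP_cons]
    congr 1
    have : 3 * ((h + g + 1 : ℕ) : ℤ) - 2 - (3 * (h : ℤ) - 2) ≡ 3 [ZMOD 6] ↔ Even g := by
      rw [Nat.even_iff, Int.ModEq]
      push_cast
      omega
    simp only [this, decide_eq_true_eq]

/-- The lists of length `s`. -/
def strictSet (s : ℕ) : Set (List ℕ) := {l | l.length = s}

/-- The lists of length `s` with `k` even entries. -/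
def changeSet (s k : ℕ) : Set (List ℕ) := {l | l.length = s ∧ l.countP (fun g => Even g) = k}

theorem strictSet_zero : strictSet 0 = {[]} := by
  ext l; simp [strictSet]

theorem gf_strictSet_succ (c s : ℕ) (hc : 0 < c)
    (ih : FinFib (fun l => c * sumWeight l) (strictSet s)) :
    FinFib (fun l => c * sumWeight l) (strictSet (s + 1)) ∧
    gf (fun l => c * sumWeight l) (strictSet (s + 1)) * (1 - X ^ (c * (s + 1))) =
      X ^ (c * (s + 1)) * gf (fun l => c * sumWeight l) (strictSet s) := by
  have hnil : [] ∉ strictSet (s + 1) := by simp [strictSet]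
  have hmem : ∀ (y : Unit) g l, Equiv.uniqueProd ℕ Unit (y, g) :: l ∈ strictSet (s + 1) ↔
      l ∈ strictSet s := by intro y g l; simp [strictSet]
  have hw : ∀ (y : Unit) g l, l ∈ strictSet s →
      c * sumWeight (Equiv.uniqueProd ℕ Unit (y, g) :: l) =
        c * (s + 1) * g + c * (s + 1) + c * sumWeight l := by
    intro y g l hl
    have : l.length = s := hl
    simp only [Equiv.uniqueProd_apply, sumWeight, this]; ring
  refine ⟨finFib_cons _ _ _ (fun _ => strictSet s) (fun _ l => c * sumWeight l)
    (fun _ => c * (s + 1)) _ (by positivity) hnil hmem hw fun _ => ih, ?_⟩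
  rw [gf_cons _ _ _ (fun _ => strictSet s) (fun _ l => c * sumWeight l)
    (fun _ => c * (s + 1)) _ (by positivity) hnil hmem hw fun _ => ih]
  simp

theorem finFib_strictSet {c : ℕ} (hc : 0 < c) (s : ℕ) :
    FinFib (fun l => c * sumWeight l) (strictSet s) := by
  induction s with
  | zero => rw [strictSet_zero]; exact finFib_singleton _ _
  | succ s ih => exact (gf_strictSet_succ c s hc ih).1

theorem gf_strictSet_one (s : ℕ) : gf (fun l => 1 * sumWeight l) (strictSet s) * qPoch s =
    X ^ (s + 1).choose 2 := by
  induction s with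
  | zero => simp [strictSet_zero, gf_singleton, sumWeight, qPoch]
  | succ s ih =>
    have h := (gf_strictSet_succ 1 s one_pos (finFib_strictSet one_pos s)).2
    rw [one_mul (s + 1)] at h
    rw [qPoch_succ, Nat.choose_succ_succ (s + 1) 1, Nat.choose_one_right, pow_add]
    linear_combination qPoch s * h + X ^ (s + 1) * ih

theorem gf_strictSet_two (s : ℕ) : gf (fun l => 2 * sumWeight l) (strictSet s) * qPochSq s =
    X ^ (s * (s + 1)) := by
  induction s with
  | zero => simp [strictSet_zero, gf_singleton, sumWeight, qPochSq]
  | succ s ih =>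
    have h := (gf_strictSet_succ 2 s two_pos (finFib_strictSet two_pos s)).2
    have e : (s + 1) * (s + 1 + 1) = 2 * (s + 1) + s * (s + 1) := by ring
    rw [qPochSq_succ, e, pow_add]
    linear_combination qPochSq s * h + X ^ (2 * (s + 1)) * ih

/-- The first gap is split as `2 * g` plus a parity bit. A unit of `g` weighs `2 * (s + 1)`, and an
odd gap costs a further `s + 1`, as an overline does. -/
theorem gf_changeSet_succ (s k : ℕ) (ih : ∀ k, FinFib sumWeight (changeSet s k)) :
    FinFib sumWeight (changeSet (s + 1) k) ∧
    gf sumWeight (changeSet (s + 1) k) * (1 - X ^ (2 * (s + 1))) =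
      X ^ (2 * (s + 1)) * gf sumWeight (changeSet s k) +
      X ^ (s + 1) * if k = 0 then 0 else gf sumWeight (changeSet s (k - 1)) := by
  let S' : Bool → Set (List ℕ) := fun b =>
    match b with
    | true => changeSet s k
    | false => if k = 0 then ∅ else changeSet s (k - 1)
  have hnil : [] ∉ changeSet (s + 1) k := by simp [changeSet]
  have hmem : ∀ (b : Bool) g l, Equiv.boolProdNatEquivNat (b, g) :: l ∈ changeSet (s + 1) k ↔
      l ∈ S' b := by
    intro b g l
    cases b with
    | true => simp [S', changeSet]
    | false =>
      cases k <;> simp [S', changeSet]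
  have hw : ∀ (b : Bool) g l, l ∈ S' b →
      sumWeight (Equiv.boolProdNatEquivNat (b, g) :: l) =
        2 * (s + 1) * g + (s + 1) * (b.toNat + 1) + sumWeight l := by
    intro b g l hl
    have : l.length = s := by
      cases b with
      | true => exact hl.1
      | false =>
        simp only [S'] at hl
        split_ifs at hl with h
        · exact hl.elim
        · exact hl.1
    cases b <;> simp [sumWeight, this] <;> ring
  have hf : ∀ b, FinFib sumWeight (S' b) := by
    intro b
    cases b with
    | true => exact ih k
    | false =>
      simp only [S']
      split_ifs
      · exact finFib_empty _
      · exact ih _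
  refine ⟨finFib_cons _ _ _ S' (fun _ => sumWeight) (fun b => (s + 1) * (b.toNat + 1)) _
    (by positivity) hnil hmem hw hf, ?_⟩
  rw [gf_cons _ _ _ S' (fun _ => sumWeight) (fun b => (s + 1) * (b.toNat + 1)) _
    (by positivity) hnil hmem hw hf, Fintype.sum_bool]
  simp only [S', Bool.toNat_true, Bool.toNat_false]
  split_ifs
  · rw [gf_empty]; ring
  · ring

theorem changeSet_zero (k : ℕ) : changeSet 0 k = if k = 0 then {[]} else ∅ := by
  ext l
  split_ifs with h
  · simp only [changeSet, Set.mem_ofPred_eq, List.length_eq_zero_iff, Set.mem_singleton_iff]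
    constructor
    · exact fun h => h.1
    · rintro rfl; exact ⟨rfl, h.symm⟩
  · simp only [changeSet, Set.mem_ofPred_eq, List.length_eq_zero_iff, Set.mem_empty_iff_false,
      iff_false]
    rintro ⟨rfl, h'⟩; exact h h'.symm

theorem finFib_changeSet (s k : ℕ) : FinFib sumWeight (changeSet s k) := by
  induction s generalizing k with
  | zero =>
    rw [changeSet_zero]
    split_ifs
    exacts [finFib_singleton _ _, finFib_empty _]
  | succ s ih => exact (gf_changeSet_succ s k ih).1

theorem gf_changeSet (s k : ℕ) : gf sumWeight (changeSet s k) * qPochSq s =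
    X ^ (s + 1).choose 2 * overlineGF s 0 k := by
  induction s generalizing k with
  | zero =>
    rw [changeSet_zero]
    cases k <;> simp [gf_singleton, gf_empty, sumWeight, qPochSq, overlineGF]
  | succ s ih =>
    have h := (gf_changeSet_succ s k (finFib_changeSet s)).2
    rw [qPochSq_succ, Nat.choose_succ_succ (s + 1) 1, Nat.choose_one_right, pow_add]
    cases k with
    | zero =>
      rw [overlineGF]
      simp only [reduceIte] at h
      linear_combination qPochSq s * h + X ^ (2 * (s + 1)) * ih 0
    | succ k =>
      rw [overlineGF]
      simp only [Nat.add_eq_zero_iff, one_ne_zero, and_false, reduceIte, Nat.add_sub_cancel] at h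
      linear_combination qPochSq s * h + X ^ (2 * (s + 1)) * ih (k + 1) + X ^ (s + 1) * ih k

/-! ### Splitting partitions into residue classes modulo 3 -/

/-- The multisets of parts of the partitions counted by `countD n k i j`. -/
def distSet (n k i j : ℕ) : Set (Multiset ℕ) :=
  {M | (∀ m ∈ M, 0 < m) ∧ M.sum = n ∧ M.Nodup ∧ (∀ m ∈ M, ¬ m ≡ 5 [MOD 6]) ∧
    M.countP (fun m => m ≡ 1 [MOD 3]) = i ∧ M.countP (fun m => m ≡ 2 [MOD 3]) = j ∧
    numChanges (((M.filter (fun m => m ≡ 1 [MOD 3])).sort (· ≥ ·)).map (fun m : ℕ => (m : ℤ)) ++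
      [-2]) = k}

theorem image_parts (n k i j : ℕ) :
    (fun p : n.Partition => p.parts) '' {p | p.parts.Nodup ∧ (∀ m ∈ p.parts, ¬ m ≡ 5 [MOD 6]) ∧
      p.parts.countP (fun m => m ≡ 1 [MOD 3]) = i ∧
      p.parts.countP (fun m => m ≡ 2 [MOD 3]) = j ∧
      numChanges (oneModThree p) = k} = distSet n k i j := by
  ext M
  constructor
  · rintro ⟨p, ⟨h1, h2, h3, h4, h5⟩, rfl⟩
    exact ⟨fun m hm => p.parts_pos hm, p.parts_sum, h1, h2, h3, h4, h5⟩
  · rintro ⟨h1, h2, h3, h4, h5, h6, h7⟩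
    exact ⟨⟨M, fun {m} hm => h1 m hm, h2⟩, ⟨h3, h4, h5, h6, h7⟩, rfl⟩

theorem countD_eq_ncard (n k i j : ℕ) : countD n k i j = (distSet n k i j).ncard := by
  rw [← image_parts, Set.InjOn.ncard_image, countD, ← Set.ncard_coe_finset]
  · congr 1
    ext p; simp
  · intro p _ q _ h
    exact Nat.Partition.ext h

theorem distSet_finite (n k i j : ℕ) : (distSet n k i j).Finite := by
  rw [← image_parts]
  exact (Set.toFinite _).image _

/-- The partition with given differences between the parts in each residue class modulo `3`. -/
def assemble (x : List ℕ × List ℕ × List ℕ) : Multiset ℕ :=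
  ((partialSums 0 x.1).map (fun h => 3 * h) : List ℕ) +
    (((partialSums 0 x.2.1).map (fun h => 6 * h - 4) : List ℕ) +
      ((partialSums 0 x.2.2).map (fun h => 3 * h - 2) : List ℕ))

theorem filter_coe_map {l : List ℕ} {f : ℕ → ℕ} {r : ℕ} (hf : ∀ h ∈ l, f h % 3 = r % 3)
    (r' : ℕ) : Multiset.filter (fun m => m ≡ r' [MOD 3]) (l.map f : List ℕ) =
      if r % 3 = r' % 3 then ((l.map f : List ℕ) : Multiset ℕ) else 0 := by
  split_ifs with h
  · rw [Multiset.filter_eq_self]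
    intro m hm
    obtain ⟨a, ha, rfl⟩ := List.mem_map.1 (Multiset.mem_coe.1 hm)
    exact (hf a ha).trans h
  · rw [Multiset.filter_eq_nil]
    intro m hm hm'
    obtain ⟨a, ha, rfl⟩ := List.mem_map.1 (Multiset.mem_coe.1 hm)
    exact h ((hf a ha).symm.trans hm')

theorem filter_assemble (x : List ℕ × List ℕ × List ℕ) :
    (assemble x).filter (fun m => m ≡ 0 [MOD 3]) =
      ((partialSums 0 x.1).map (fun h => 3 * h) : List ℕ) ∧
    (assemble x).filter (fun m => m ≡ 2 [MOD 3]) =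
      ((partialSums 0 x.2.1).map (fun h => 6 * h - 4) : List ℕ) ∧
    (assemble x).filter (fun m => m ≡ 1 [MOD 3]) =
      ((partialSums 0 x.2.2).map (fun h => 3 * h - 2) : List ℕ) := by
  have h0 := fun r' => filter_coe_map (l := partialSums 0 x.1) (f := fun h => 3 * h) (r := 0)
    (fun h _ => by simp) r'
  have h2 := fun r' => filter_coe_map (l := partialSums 0 x.2.1) (f := fun h => 6 * h - 4)
    (r := 2) (fun h hh => by have := pos_of_mem_partialSums hh; omega) r'
  have h1 := fun r' => filter_coe_map (l := partialSums 0 x.2.2) (f := fun h => 3 * h - 2)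
    (r := 1) (fun h hh => by have := pos_of_mem_partialSums hh; omega) r'
  simp only [assemble, Multiset.filter_add, h0, h1, h2]
  simp

/-- A function is increasing on the positive integers. -/
def IncrPos (f : ℕ → ℕ) : Prop := ∀ a b, 0 < a → a < b → f a < f b

theorem pairwise_map_partialSums {f : ℕ → ℕ} (hf : IncrPos f) (l : List ℕ) :
    ((partialSums 0 l).map f).Pairwise (· < ·) := by
  rw [List.pairwise_map]
  refine (List.pairwise_cons.1 (pairwise_partialSums 0 l)).2.imp_of_mem ?_
  intro a b ha _ hab
  exact hf a b (pos_of_mem_partialSums ha) hab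

theorem sort_coe_map {f : ℕ → ℕ} (hf : IncrPos f) (l : List ℕ) :
    Multiset.sort ((partialSums 0 l).map f : List ℕ) (· ≤ ·) = (partialSums 0 l).map f := by
  refine List.Perm.eq_of_pairwise (le := (· ≤ ·)) (fun a b _ _ h h' => le_antisymm h h')
    (Multiset.pairwise_sort _ _) ((pairwise_map_partialSums hf l).imp le_of_lt) ?_
  rw [← Multiset.coe_eq_coe, Multiset.sort_eq]

theorem sort_ge_coe_map {f : ℕ → ℕ} (hf : IncrPos f) (l : List ℕ) :
    Multiset.sort ((partialSums 0 l).map f : List ℕ) (· ≥ ·) =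
      ((partialSums 0 l).map f).reverse := by
  refine List.Perm.eq_of_pairwise (le := (· ≥ ·)) (fun a b _ _ h h' => le_antisymm h' h)
    (Multiset.pairwise_sort _ _) ?_ ?_
  · rw [List.pairwise_reverse]
    exact (pairwise_map_partialSums hf l).imp le_of_lt
  · rw [← Multiset.coe_eq_coe, Multiset.sort_eq, Multiset.coe_reverse]

/-- The differences between the elements of a multiset, rescaled by `g`. -/
def classDiffs (g : ℕ → ℕ) (M : Multiset ℕ) : List ℕ :=
  differences 0 ((M.sort (· ≤ ·)).map g)

theorem classDiffs_coe_map {f g : ℕ → ℕ} (hf : IncrPos f) (hg : ∀ h, 0 < h → g (f h) = h)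
    (l : List ℕ) : classDiffs g ((partialSums 0 l).map f : List ℕ) = l := by
  rw [classDiffs, sort_coe_map hf, List.map_map]
  have : (partialSums 0 l).map (g ∘ f) = partialSums 0 l := by
    refine (List.map_congr_left fun h hh => ?_).trans (List.map_id _)
    exact hg h (pos_of_mem_partialSums hh)
  rw [this, differences_partialSums]

theorem coe_map_classDiffs {f g : ℕ → ℕ} {M : Multiset ℕ} (hM : M.Nodup)
    (hg : ∀ m ∈ M, 0 < g m ∧ f (g m) = m) (hlt : ∀ m ∈ M, ∀ m' ∈ M, m < m' → g m < g m') :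
    ((partialSums 0 (classDiffs g M)).map f : List ℕ) = M := by
  rw [classDiffs, partialSums_differences, List.map_map]
  · have : (M.sort (· ≤ ·)).map (f ∘ g) = M.sort (· ≤ ·) := by
      refine (List.map_congr_left fun m hm => ?_).trans (List.map_id _)
      exact (hg m ((Multiset.mem_sort _).1 hm)).2
    rw [this, Multiset.sort_eq]
  · rw [List.pairwise_cons]
    constructor
    · intro a ha
      obtain ⟨m, hm, rfl⟩ := List.mem_map.1 ha
      exact (hg m ((Multiset.mem_sort _).1 hm)).1
    · rw [List.pairwise_map]
      have h1 : (M.sort (· ≤ ·)).Nodup := by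
        rw [← Multiset.coe_nodup, Multiset.sort_eq]; exact hM
      have h2 := (Multiset.pairwise_sort M (· ≤ ·)).and h1
      refine h2.imp_of_mem ?_
      intro a b ha hb hab
      exact hlt a ((Multiset.mem_sort _).1 ha) b ((Multiset.mem_sort _).1 hb)
        (lt_of_le_of_ne hab.1 hab.2)

theorem incrPos_three : IncrPos fun h => 3 * h := fun a b _ _ => by simp only; omega
theorem incrPos_six : IncrPos fun h => 6 * h - 4 := fun a b _ _ => by simp only; omega
theorem incrPos_three_sub : IncrPos fun h => 3 * h - 2 := fun a b _ _ => by simp only; omega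

/-- The lists of differences within each residue class modulo `3` of a partition. -/
def disassemble (M : Multiset ℕ) : List ℕ × List ℕ × List ℕ :=
  (classDiffs (· / 3) (M.filter (fun m => m ≡ 0 [MOD 3])),
    classDiffs (fun m => (m + 4) / 6) (M.filter (fun m => m ≡ 2 [MOD 3])),
    classDiffs (fun m => (m + 2) / 3) (M.filter (fun m => m ≡ 1 [MOD 3])))

theorem disassemble_assemble (x : List ℕ × List ℕ × List ℕ) :
    disassemble (assemble x) = x := by
  obtain ⟨h0, h2, h1⟩ := filter_assemble x
  rw [disassemble, h0, h1, h2, classDiffs_coe_map incrPos_three fun h _ => by omega,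
    classDiffs_coe_map incrPos_six fun h _ => by omega,
    classDiffs_coe_map incrPos_three_sub fun h _ => by omega]

theorem assemble_disassemble {M : Multiset ℕ} (hpos : ∀ m ∈ M, 0 < m) (hM : M.Nodup)
    (h5 : ∀ m ∈ M, ¬ m ≡ 5 [MOD 6]) : assemble (disassemble M) = M := by
  simp only [assemble, disassemble]
  rw [coe_map_classDiffs (hM.filter _), coe_map_classDiffs (hM.filter _),
    coe_map_classDiffs (hM.filter _)]
  · have e1 := Multiset.filter_add_not (fun m => m ≡ 0 [MOD 3]) M
    have e2 := Multiset.filter_add_not (fun m => m ≡ 2 [MOD 3])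
      (M.filter fun m => ¬ m ≡ 0 [MOD 3])
    rw [Multiset.filter_filter, Multiset.filter_filter] at e2
    conv_rhs => rw [← e1, ← e2]
    congr 2 <;> refine Multiset.filter_congr fun m _ => ?_ <;> simp only [Nat.ModEq] <;> omega
  -- The parts congruent to 2 modulo 3 but not to 5 modulo 6 are 2 modulo 6, hence of the form `6 *
  -- h - 4`.
  all_goals
    intro m hm
    rw [Multiset.mem_filter] at hm
    obtain ⟨hm, hr⟩ := hm
    have h0 := hpos m hm
    have h5m := h5 m hm
    rw [Nat.ModEq] at hr h5m
    try
      intro m' hm'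
      rw [Multiset.mem_filter] at hm'
      obtain ⟨hm', hr'⟩ := hm'
      have h5m' := h5 m' hm'
      rw [Nat.ModEq] at hr' h5m'
    omega

theorem sum_map_add {l : List ℕ} {f : ℕ → ℕ} {c d : ℕ} (hf : ∀ h ∈ l, f h + c = d * h) :
    (l.map f).sum + c * l.length = d * l.sum := by
  induction l with
  | nil => rfl
  | cons a l ih =>
    simp only [List.map_cons, List.sum_cons, List.length_cons]
    rw [mul_add d, ← ih fun h hh => hf h (List.mem_cons_of_mem _ hh), ← hf a (by simp)]
    ring

theorem sum_assemble (x : List ℕ × List ℕ × List ℕ) :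
    (assemble x).sum + 4 * x.2.1.length + 2 * x.2.2.length =
      3 * (1 * sumWeight x.1 + (2 * sumWeight x.2.1 + sumWeight x.2.2)) := by
  have h0 := sum_map_add (l := partialSums 0 x.1) (f := fun h => 3 * h) (c := 0) (d := 3)
    fun h _ => by simp
  have h2 := sum_map_add (l := partialSums 0 x.2.1) (f := fun h => 6 * h - 4) (c := 4) (d := 6)
    fun h hh => by have := pos_of_mem_partialSums hh; omega
  have h1 := sum_map_add (l := partialSums 0 x.2.2) (f := fun h => 3 * h - 2) (c := 2) (d := 3)
    fun h hh => by have := pos_of_mem_partialSums hh; omega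
  rw [sum_partialSums, length_partialSums] at h0 h1 h2
  simp only [assemble, Multiset.sum_add, Multiset.sum_coe]
  omega

theorem assemble_spec (x : List ℕ × List ℕ × List ℕ) :
    (∀ m ∈ assemble x, 0 < m) ∧ (assemble x).Nodup ∧ (∀ m ∈ assemble x, ¬ m ≡ 5 [MOD 6]) := by
  have hmem : ∀ m ∈ assemble x, (∃ h, 0 < h ∧ m = 3 * h) ∨ (∃ h, 0 < h ∧ m = 6 * h - 4) ∨
      ∃ h, 0 < h ∧ m = 3 * h - 2 := by
    intro m hm
    simp only [assemble, Multiset.mem_add, Multiset.mem_coe, List.mem_map] at hm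
    rcases hm with ⟨h, hh, rfl⟩ | ⟨h, hh, rfl⟩ | ⟨h, hh, rfl⟩
    · exact .inl ⟨h, pos_of_mem_partialSums hh, rfl⟩
    · exact .inr (.inl ⟨h, pos_of_mem_partialSums hh, rfl⟩)
    · exact .inr (.inr ⟨h, pos_of_mem_partialSums hh, rfl⟩)
  refine ⟨?_, ?_, ?_⟩
  · intro m hm
    rcases hmem m hm with ⟨h, hh, rfl⟩ | ⟨h, hh, rfl⟩ | ⟨h, hh, rfl⟩ <;> omega
  · have nd : ∀ f l, IncrPos f → (((partialSums 0 l).map f : List ℕ) : Multiset ℕ).Nodup :=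
      fun f l hf => Multiset.coe_nodup.2 ((pairwise_map_partialSums hf l).imp ne_of_lt)
    rw [assemble, Multiset.nodup_add, Multiset.nodup_add]
    refine ⟨nd _ _ incrPos_three, ⟨nd _ _ incrPos_six, nd _ _ incrPos_three_sub, ?_⟩, ?_⟩
    · rw [Multiset.disjoint_left]
      intro a ha hb
      simp only [Multiset.mem_coe, List.mem_map] at ha hb
      obtain ⟨h, hh, rfl⟩ := ha
      obtain ⟨h', hh', e⟩ := hb
      have := pos_of_mem_partialSums hh
      have := pos_of_mem_partialSums hh'
      omega
    · rw [Multiset.disjoint_left]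
      intro a ha hb
      simp only [Multiset.mem_add, Multiset.mem_coe, List.mem_map] at ha hb
      obtain ⟨h, hh, rfl⟩ := ha
      rcases hb with ⟨h', hh', e⟩ | ⟨h', hh', e⟩ <;>
      · have := pos_of_mem_partialSums hh
        have := pos_of_mem_partialSums hh'
        omega
  · intro m hm
    rw [Nat.ModEq]
    rcases hmem m hm with ⟨h, hh, rfl⟩ | ⟨h, hh, rfl⟩ | ⟨h, hh, rfl⟩ <;> omega

theorem counts_assemble (x : List ℕ × List ℕ × List ℕ) :
    (assemble x).countP (fun m => m ≡ 0 [MOD 3]) = x.1.length ∧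
    (assemble x).countP (fun m => m ≡ 2 [MOD 3]) = x.2.1.length ∧
    (assemble x).countP (fun m => m ≡ 1 [MOD 3]) = x.2.2.length ∧
    numChanges ((((assemble x).filter (fun m => m ≡ 1 [MOD 3])).sort (· ≥ ·)).map
      (fun m : ℕ => (m : ℤ)) ++ [-2]) = x.2.2.countP (fun g => Even g) := by
  obtain ⟨h0, h2, h1⟩ := filter_assemble x
  simp only [Multiset.countP_eq_card_filter]
  rw [h0, h1, h2, sort_ge_coe_map incrPos_three_sub]
  refine ⟨by simp [length_partialSums], by simp [length_partialSums],
    by simp [length_partialSums], ?_⟩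
  have := numChanges_partialSums 0 x.2.2
  rw [← this]
  congr 2
  rw [List.map_reverse, List.map_reverse, List.map_map]
  congr 1
  refine List.map_congr_left fun h hh => ?_
  have := pos_of_mem_partialSums hh
  simp only [Function.comp]
  omega

theorem ncard_dist {n k i j m : ℕ} (z : ℕ) (hm : n + 2 * i + 4 * j = 3 * m) :
    {M | M ∈ distSet n k i j ∧ M.countP (fun m => m ≡ 0 [MOD 3]) = z}.ncard =
      (fiber (fun x : List ℕ × List ℕ × List ℕ =>
        1 * sumWeight x.1 + (2 * sumWeight x.2.1 + sumWeight x.2.2))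
        (strictSet z ×ˢ strictSet j ×ˢ changeSet i k) m).ncard := by
  have hb : Set.BijOn assemble
      (fiber (fun x : List ℕ × List ℕ × List ℕ =>
        1 * sumWeight x.1 + (2 * sumWeight x.2.1 + sumWeight x.2.2))
        (strictSet z ×ˢ strictSet j ×ˢ changeSet i k) m)
      {M | M ∈ distSet n k i j ∧ M.countP (fun m => m ≡ 0 [MOD 3]) = z} := by
    refine Set.InvOn.bijOn (f' := disassemble)
      ⟨fun x _ => disassemble_assemble x, ?_⟩ ?_ ?_
    · rintro M ⟨⟨h1, -, h3, h4, -⟩, -⟩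
      exact assemble_disassemble h1 h3 h4
    · rintro x ⟨⟨h0, h2, h1, h3⟩, hw⟩
      obtain ⟨a1, a2, a3⟩ := assemble_spec x
      obtain ⟨c0, c2, c1, c3⟩ := counts_assemble x
      have hs := sum_assemble x
      simp only [strictSet, Set.mem_ofPred_eq] at h0 h1 h2 hw
      rw [hw, h1, h2] at hs
      exact ⟨⟨a1, by omega, a2, a3, c1.trans h1, c2.trans h2, c3.trans h3⟩, c0.trans h0⟩
    · rintro M ⟨⟨h1, h2, h3, h4, h5, h6, h7⟩, h8⟩
      have e := assemble_disassemble h1 h3 h4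
      obtain ⟨c0, c2, c1, c3⟩ := counts_assemble (disassemble M)
      have hs := sum_assemble (disassemble M)
      rw [e] at c0 c1 c2 c3 hs
      rw [← c2, ← c1, h6, h5, h2] at hs
      exact ⟨⟨c0.symm.trans h8, c2.symm.trans h6, c1.symm.trans h5, c3.symm.trans h7⟩, by
        simp only; omega⟩
  rw [← hb.image_eq, Set.InjOn.ncard_image hb.injOn]

theorem mod_of_mem_distSet {n k i j : ℕ} {M} (h : M ∈ distSet n k i j) :
    ∃ m, n + 2 * i + 4 * j = 3 * m := by
  obtain ⟨h1, h2, h3, h4, h5, h6, -⟩ := h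
  have e := assemble_disassemble h1 h3 h4
  obtain ⟨-, c2, c1, -⟩ := counts_assemble (disassemble M)
  have hs := sum_assemble (disassemble M)
  rw [e] at c1 c2 hs
  rw [← c2, ← c1, h6, h5, h2] at hs
  exact ⟨_, Eq.trans (by ring) hs⟩

theorem countP_le_of_mem_distSet {n k i j : ℕ} {M} (h : M ∈ distSet n k i j) :
    M.countP (fun m => m ≡ 0 [MOD 3]) ≤ n := by
  obtain ⟨h1, h2, -⟩ := h
  rw [← h2]
  refine (Multiset.countP_le_card _ _).trans ?_
  have := Multiset.card_nsmul_le_sum (s := M) (a := 1) fun m hm => h1 m hm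
  simpa using this

theorem countD_eq_sum {n k i j m K : ℕ} (hm : n + 2 * i + 4 * j = 3 * m) (hK : n < K) :
    (countD n k i j : ℤ) = ∑ z ∈ range K,
      coeff m (gf (fun l => 1 * sumWeight l) (strictSet z) *
        (gf (fun l => 2 * sumWeight l) (strictSet j) * gf sumWeight (changeSet i k))) := by
  rw [countD_eq_ncard, ncard_eq_sum_fiberwise (distSet_finite n k i j)
    (Multiset.countP (fun m => m ≡ 0 [MOD 3])) K
    fun M hM => (countP_le_of_mem_distSet hM).trans_lt hK]
  push_cast
  refine Finset.sum_congr rfl fun z _ => ?_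
  have hj := finFib_strictSet two_pos j
  have hi := finFib_changeSet i k
  rw [ncard_dist z hm, ← gf_prod _ _ _ _ hj hi,
    ← gf_prod _ _ _ _ (finFib_strictSet one_pos z) (finFib_prod _ _ _ _ hj hi), coeff_gf]

theorem countD_eq_zero {n k i j : ℕ} (h : ∀ m, n + 2 * i + 4 * j ≠ 3 * m) :
    countD n k i j = 0 := by
  have : distSet n k i j = ∅ := Set.eq_empty_of_forall_notMem fun M hM => by
    obtain ⟨m, hm⟩ := mod_of_mem_distSet hM
    exact h m hm
  rw [countD_eq_ncard, this, Set.ncard_empty]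

/-! ### Comparison of the two sides -/

/-- The generating functions of both sides agree modulo `X ^ K`, up to a factor `X ^ j`. -/
theorem X_pow_dvd_gf_sub (k i j K : ℕ) :
    X ^ K ∣ ∑ z ∈ range K, gf (fun l => 1 * sumWeight l) (strictSet z) *
        (gf (fun l => 2 * sumWeight l) (strictSet j) * gf sumWeight (changeSet i k)) -
      X ^ j * ∑ z ∈ range K, gf (gapWeight 1) (gapSet ![z, i, j] (z + j) k) := by
  set A : ℕ → ℤ⟦X⟧ := fun z => gf (fun l => 1 * sumWeight l) (strictSet z)
  set B : ℤ⟦X⟧ := gf (fun l => 2 * sumWeight l) (strictSet j)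
  set E : ℤ⟦X⟧ := gf sumWeight (changeSet i k)
  have hA : ∀ z, A z * qPoch z = X ^ (z + 1).choose 2 := gf_strictSet_one
  have hB : B * qPochSq j = X ^ (j * (j + 1)) := gf_strictSet_two j
  have hE : E * qPochSq i = X ^ (i + 1).choose 2 * overlineGF i 0 k := gf_changeSet i k
  have hA' : ∀ z, A (z + 1) * (1 - X ^ (z + 1)) = X ^ (z + 1) * A z := by
    intro z
    have h := (gf_strictSet_succ 1 z one_pos (finFib_strictSet one_pos z)).2
    rwa [one_mul (z + 1)] at h
  have hterm : ∀ z, X ^ j * gf (gapWeight 1) (gapSet ![z, i, j] (z + j) k) =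
      B * E * (qPochNeg (i + j) * (X ^ (z * (i + j)) * A z)) := by
    intro z
    have h := (gf_gapSet (z + i + j) ![z, i, j] rfl).2 1 (z + j) k (by omega)
    have hs : z + i + j = i + (z + j) := by ring
    rw [GapFormula, hs, overlineGF_add] at h
    simp only [gapDenom, gapNum, Matrix.cons_val_zero, Matrix.cons_val_one, Matrix.cons_val] at h
    set G := gf (gapWeight 1) (gapSet ![z, i, j] (z + j) k)
    have h' : G * (qPoch z * qPoch (i + j) * qPochSq i * qPochSq j) =
        X ^ diffChoose i j * qPochSq (i + j) *
          (X ^ (i * (z + j) + (z + j + 1).choose 2) * overlineGF i 0 k) := by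
      refine mul_right_cancel₀ (one_add_X_pow_ne_zero (i + j)) ?_
      linear_combination h
    have hexp : j + diffChoose i j + (i * (z + j) + (z + j + 1).choose 2) =
        (i + 1).choose 2 + j * (j + 1) + z * (i + j) + (z + 1).choose 2 := by
      have := diffChoose_eq i j
      have hc : (z + j + 1).choose 2 = (z + 1).choose 2 + (j + 1).choose 2 + z * j := by
        clear * -
        induction j with
        | zero => simp
        | succ j ih =>
          have h1 := Nat.choose_succ_succ (z + j + 1) 1
          have h2 := Nat.choose_succ_succ (j + 1) 1
          simp only [Nat.succ_eq_add_one, Nat.reduceAdd, Nat.choose_one_right] at h1 h2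
          rw [← add_assoc z j 1, h1, h2, ih]; ring
      rw [hc]
      linarith
    have hX : (X ^ j * X ^ diffChoose i j * X ^ (i * (z + j) + (z + j + 1).choose 2) : ℤ⟦X⟧) =
        X ^ (i + 1).choose 2 * X ^ (j * (j + 1)) * X ^ (z * (i + j)) * X ^ (z + 1).choose 2 := by
      simp only [← pow_add, hexp]
    have hne : qPoch z * qPoch (i + j) * qPochSq i * qPochSq j ≠ 0 :=
      mul_ne_zero (mul_ne_zero (mul_ne_zero (qPoch_ne_zero _) (qPoch_ne_zero _))
        (qPochSq_ne_zero _)) (qPochSq_ne_zero _)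
    refine mul_right_cancel₀ hne ?_
    calc X ^ j * G * (qPoch z * qPoch (i + j) * qPochSq i * qPochSq j)
        = (X ^ j * X ^ diffChoose i j * X ^ (i * (z + j) + (z + j + 1).choose 2)) *
            qPochSq (i + j) * overlineGF i 0 k := by
          linear_combination X ^ j * h'
      _ = (B * qPochSq j) * (E * qPochSq i) * (A z * qPoch z) * qPochSq (i + j) *
            X ^ (z * (i + j)) := by
          rw [hX, hA, hB, hE]; ring
      _ = _ := by rw [qPochSq_eq (i + j)]; ring
  have hsum : ∑ z ∈ range K, A z * (B * E) -
      X ^ j * ∑ z ∈ range K, gf (gapWeight 1) (gapSet ![z, i, j] (z + j) k) =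
      B * E * (∑ z ∈ range K, A z -
        qPochNeg (i + j) * ∑ z ∈ range K, X ^ (z * (i + j)) * A z) := by
    rw [mul_sum, sum_congr rfl fun z _ => hterm z, ← mul_sum, ← mul_sum, ← sum_mul]
    ring
  rw [hsum]
  exact (X_pow_dvd_sum_sub hA' K (i + j)).mul_left _

end Capparelli

theorem mainTheorem7 (n k i j : ℕ) :
    Capparelli.countC n k i j = Capparelli.countD n k i j := by
  by_cases h : ∃ m, n + 2 * i + j = 3 * m
  · obtain ⟨m, hm⟩ := h
    -- The truncation exceeds both `n`, which bounds the number of multiples of 3, and `m + j`, the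
    -- coefficient to be read. The weights are `m` and `m + j` on the two sides, which accounts for
    -- the factor `X ^ j`.
    have hK : n < n + m + j + 1 := by omega
    have hm' : n + 2 * i + 4 * j = 3 * (m + j) := by omega
    have hdvd := Capparelli.X_pow_dvd_gf_sub k i j (n + m + j + 1)
    rw [PowerSeries.X_pow_dvd_iff] at hdvd
    have h0 := hdvd (m + j) (by omega)
    rw [map_sub, PowerSeries.coeff_X_pow_mul, map_sum, map_sum,
      ← Capparelli.countC_eq_sum hm hK, ← Capparelli.countD_eq_sum hm' hK, sub_eq_zero] at h0
    exact_mod_cast h0.symm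
  · push Not at h
    rw [Capparelli.countC_eq_zero h, Capparelli.countD_eq_zero]
    intro m hm
    exact h (m - j) (by omega)
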